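/- Let $G$ be a non-trivial countable discrete group with the infinite conjugacy class property (ICC), i.e. every $g\in G\setminus\{e\}$ has an infinite conjugacy class, and let $A$ be a finite discrete alphabet with at least two elements. Let $G$ act on $A^G$ (with the product topology) by left translations, $(gs)(h)=s(g^{-1}h)$. A \emph{shift} is a non-empty closed $G$-invariant subset of $A^G$; the set of shifts carries the subspace topology of the Hausdorff (equivalently Vietoris, or Fell) topology on the closed subsets of $A^G$. A shift $S$ is \emph{strongly irreducible} if there is a finite $X\subseteq G$ containing the identity such that for any $E_1,E_2\subseteq G$ with $E_1X\cap E_2X=\emptyset$ and any $s_1,s_2\in S$ there is an $s\in S$ with $s|_{E_1}=s_1|_{E_1}$ and $s|_{E_2}=s_2|_{E_2}$. Let $\mathcal S$ be the closure, in the space of shifts, of the set of strongly irreducible shifts, with the trivial (singleton) shifts removed, equipped with the subspace topology. Then the set of those $S\in\mathcal S$ for which the action $G\curvearrowright S$ is faithful, minimal (every orbit is dense) and proximal (for all $x,y\in S$ there is a net $(g_i)$ in $G$ such that $\lim_i g_ix$ and $\lim_i g_iy$ exist and are equal) is a dense $G_\delta$ subset of $\mathcal S$. -/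

import Mathlib

open Topology TopologicalSpace Filter

namespace GenericShifts

/-- A group has the infinite conjugacy class property if each of its non-trivial elements has an
infinite conjugacy class. -/
def IsICC (G : Type*) [Group G] : Prop :=
  ∀ g : G, g ≠ 1 → (conjugatesOf g).Infinite

/-- Left translation on the full shift: `(g s)(h) = s (g⁻¹ h)`. -/
def translate {G A : Type*} [Group G] (g : G) (s : G → A) : G → A :=
  fun h => s (g⁻¹ * h)

/-- The space of shifts: the non-empty, closed, translation-invariant subsets of `A ^ G`, with the
subspace topology of the Hausdorff (Vietoris) topology. Here `A` is a finite discrete space, so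
`G → A`, with the product topology, is compact Hausdorff and its closed subsets are exactly
its compact subsets. -/
abbrev Shift (G A : Type*) [Group G] [TopologicalSpace A] :=
  {K : NonemptyCompacts (G → A) // ∀ g : G, ∀ s ∈ K, translate g s ∈ K}

/-- The configurations of a shift, as a topological space (a subspace of `A ^ G`). -/
abbrev Shift.Points {G A : Type*} [Group G] [TopologicalSpace A] (S : Shift G A) :=
  {s : G → A // s ∈ S.1}

/-- The group acts on each shift by left translations. -/
instance Shift.mulActionPoints {G A : Type*} [Group G] [TopologicalSpace A] (S : Shift G A) :
    MulAction G S.Points where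
  smul g s := ⟨translate g s.1, S.2 g s.1 s.2⟩
  one_smul s := Subtype.ext (funext fun h => by
    change s.1 ((1 : G)⁻¹ * h) = s.1 h
    rw [inv_one, one_mul])
  mul_smul a b s := Subtype.ext (funext fun h => by
    change s.1 ((a * b)⁻¹ * h) = s.1 (b⁻¹ * (a⁻¹ * h))
    rw [mul_inv_rev, mul_assoc])

/-- A shift is trivial if it consists of a single configuration. -/
def Shift.IsTrivial {G A : Type*} [Group G] [TopologicalSpace A] (S : Shift G A) : Prop :=
  ∃ s : G → A, (S.1 : Set (G → A)) = {s}

open scoped Pointwise in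
/-- Strong irreducibility: configurations of the shift can be glued along any two sets of
coordinates that are far apart; `E * (X : Set G)` is the product set `E X`. -/
def Shift.IsStronglyIrreducible {G A : Type*} [Group G] [TopologicalSpace A]
    (S : Shift G A) : Prop :=
  ∃ X : Finset G, 1 ∈ X ∧
    ∀ E₁ E₂ : Set G, Disjoint (E₁ * (X : Set G)) (E₂ * (X : Set G)) →
      ∀ s₁ ∈ S.1, ∀ s₂ ∈ S.1, ∃ s ∈ S.1, Set.EqOn s s₁ E₁ ∧ Set.EqOn s s₂ E₂

/-- The space `𝒮`: the closure, in the space of shifts, of the strongly irreducible shifts, with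
the trivial shifts removed. -/
def genericSpace (G A : Type*) [Group G] [TopologicalSpace A] : Set (Shift G A) :=
  closure {S | S.IsStronglyIrreducible} \ {S | S.IsTrivial}

/-- An action is proximal if for any two points `x, y` there is a net `gᵢ` in the group such that
`gᵢ x` and `gᵢ y` converge to the same point. The net is given as a proper filter on `G`. -/
def IsProximalAction (G X : Type*) [Group G] [TopologicalSpace X] [MulAction G X] : Prop :=
  ∀ x y : X, ∃ l : Filter G, l.NeBot ∧ ∃ z : X,
    Tendsto (fun g : G => g • x) l (𝓝 z) ∧ Tendsto (fun g : G => g • y) l (𝓝 z)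

end GenericShifts

/-! ### Equations over ICC groups and elements that avoid them. -/

namespace GenericShifts

section Generic

open scoped Pointwise

variable {G : Type*} [Group G]

/-! The set in question is a countable intersection of open conditions: a given `g ≠ 1` moves some
configuration, and the shift is synchronizing for a given finite window `F`. Synchronizing for all
`F` is minimality together with proximality. The space is locally closed in a compact Hausdorff
space, hence Baire, so it suffices that each condition is dense.

For density, approximate by a non-trivial strongly irreducible shift `S₁`. It is automatically
faithful: the kernel is normal, so by ICC it would contain elements far from `1`, and coordinates
far apart are independent. The core is `Shift.IsStronglyIrreducible.exists_subshift`, which shrinks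
`S₁` to a strongly irreducible synchronizing subshift with the same `F`-patterns, hence close to
`S₁`.

To build it, take a configuration `s₀` that shows all `F`-patterns inside a finite window `W`, and
force copies of `s₀` on `W` at a set of markers. The markers must be spaced, so that copies do not
interfere; defined by local rules, so that the result is closed and strongly irreducible; and such
that any two admissible marker sets have a common point. The last point gives synchronization.

The markers are `D₁ * P ∪ D₂ * Q`, where `D₂` is maximal subject to spacing of the translates of
`Q`, and `D₁` is maximal among the remaining places for translates of `P`. Given two markings, take
`d` in the `D₂'` of the second. By maximality `d P` comes close to a translate of `P` or of `Q` in
the first marking, and `P`, `Q` are designed so that `d Q` then meets that translate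
(`IsMarking.exists_common`).

Such finite `P`, `Q` come from ICC (`IsICC.exists_spaced_hitting`, `IsICC.exists_spaced_pair`): they
are assembled from elements that solve no prescribed short equation, which exist by B. H. Neumann's
lemma on coverings by cosets. -/

theorem IsICC.not_finiteIndex_centralizer (hG : IsICC G) {x : G} (hx : x ≠ 1) :
    ¬ (Subgroup.centralizer {x}).FiniteIndex := by
  intro h
  apply hG x hx
  have : Finite (G ⧸ Subgroup.centralizer {x}) := Subgroup.finite_quotient_of_finiteIndex
  have hmap : ∀ a b : G, QuotientGroup.leftRel (Subgroup.centralizer {x}) a b →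
      a * x * a⁻¹ = b * x * b⁻¹ := by
    intro a b hab
    rw [QuotientGroup.leftRel_apply, Subgroup.mem_centralizer_singleton_iff] at hab
    calc a * x * a⁻¹ = a * (x * (a⁻¹ * b)) * b⁻¹ := by group
      _ = a * (a⁻¹ * b * x) * b⁻¹ := by rw [hab]
      _ = b * x * b⁻¹ := by group
  refine (Set.finite_range (Quotient.lift (fun a : G => a * x * a⁻¹) hmap)).subset ?_
  intro y hy
  obtain ⟨c, hc⟩ := isConj_iff.1 hy
  exact ⟨Quotient.mk _ c, hc⟩

/-- In an ICC group, finitely many equations `w x w⁻¹ = y` with `x ≠ 1` do not have all group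
elements as solutions. -/
theorem IsICC.exists_conj_ne (hG : IsICC G) (L : Finset (G × G)) (hL : ∀ p ∈ L, p.1 ≠ 1) :
    ∃ w : G, ∀ p ∈ L, w * p.1 * w⁻¹ ≠ p.2 := by
  classical
  by_contra! hcon
  -- The solutions of one equation lie in a single left coset of a centralizer.
  have key : ∀ p : G × G, ∃ w₀ : G, ∀ w, w * p.1 * w⁻¹ = p.2 →
      w ∈ w₀ • (Subgroup.centralizer {p.1} : Set G) := by
    intro p
    by_cases h : ∃ w₀ : G, w₀ * p.1 * w₀⁻¹ = p.2
    · obtain ⟨w₀, h₀⟩ := h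
      refine ⟨w₀, fun w hw => ?_⟩
      rw [Set.mem_smul_set_iff_inv_smul_mem, SetLike.mem_coe,
        Subgroup.mem_centralizer_singleton_iff, smul_eq_mul]
      have : w * p.1 * w⁻¹ = w₀ * p.1 * w₀⁻¹ := hw.trans h₀.symm
      calc w₀⁻¹ * w * p.1 = w₀⁻¹ * (w * p.1 * w⁻¹) * w := by group
        _ = w₀⁻¹ * (w₀ * p.1 * w₀⁻¹) * w := by rw [this]
        _ = p.1 * (w₀⁻¹ * w) := by group
    · exact ⟨1, fun w hw => (h ⟨w, hw⟩).elim⟩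
  choose w₀ hw₀ using key
  have hcov : ⋃ p ∈ L, w₀ p • (Subgroup.centralizer {p.1} : Set G) = Set.univ := by
    refine Set.eq_univ_of_forall fun w => ?_
    obtain ⟨p, hp, hw⟩ := hcon w
    exact Set.mem_biUnion hp (hw₀ p w hw)
  -- B. H. Neumann: a finite cover by cosets involves a subgroup of finite index.
  obtain ⟨p, hp, hfin⟩ := Subgroup.exists_finiteIndex_of_leftCoset_cover
    (H := fun p : G × G => Subgroup.centralizer {p.1}) hcov
  exact hG.not_finiteIndex_centralizer (hL p hp) hfin

theorem IsICC.infinite [Nontrivial G] (hG : IsICC G) : Infinite G := by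
  obtain ⟨x, hx⟩ := exists_ne (1 : G)
  exact Set.infinite_univ_iff.1 ((hG x hx).mono (Set.subset_univ _))

/-- An element that solves no non-trivial equation of degree at most two, in one variable, with
coefficients in `Φ`. -/
structure IsFree (Φ : Finset G) (w : G) : Prop where
  ne : ∀ x ∈ Φ, w ≠ x
  conj_ne : ∀ x ∈ Φ, x ≠ 1 → ∀ y ∈ Φ, w * x * w⁻¹ ≠ y
  sq_ne : ∀ x ∈ Φ, ∀ y ∈ Φ, w * x * w ≠ y

theorem IsFree.mono {Φ Ψ : Finset G} (h : Φ ⊆ Ψ) {w : G} (hw : IsFree Ψ w) : IsFree Φ w :=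
  ⟨fun x hx => hw.ne x (h hx), fun x hx h1 y hy => hw.conj_ne x (h hx) h1 y (h hy),
    fun x hx y hy => hw.sq_ne x (h hx) y (h hy)⟩

/-- The solutions of `(w f)² = 1` need not form a coset, so two candidates `a` and `a b` are tried.
If both fail, eliminating `a⁻¹` from the two square equations leaves a conjugation equation for `a`,
whose coefficient is non-trivial because `b ∉ Φ Φ⁻¹`; `a` was chosen to avoid it. -/
theorem IsICC.exists_conj_ne_sq_ne [Nontrivial G] (hG : IsICC G) (L : Finset (G × G))
    (hL : ∀ p ∈ L, p.1 ≠ 1) (Φ : Finset G) :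
    ∃ w : G, (∀ p ∈ L, w * p.1 * w⁻¹ ≠ p.2) ∧ ∀ f ∈ Φ, w * f * (w * f) ≠ 1 := by
  classical
  have := hG.infinite
  obtain ⟨b, hb⟩ := Infinite.exists_notMem_finset
    ((Φ ×ˢ Φ).image fun p => p.1 * p.2⁻¹)
  let L' : Finset (G × G) := L ∪ L.image (fun p => (b * p.1 * b⁻¹, p.2)) ∪
    (Φ ×ˢ Φ).image (fun p => (p.1 * p.2⁻¹ * b⁻¹, p.1⁻¹ * (b * p.2)))
  obtain ⟨a, ha⟩ := hG.exists_conj_ne L' (by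
    intro p hp
    simp only [L', Finset.mem_union, Finset.mem_image, Finset.mem_product, Prod.exists] at hp
    rcases hp with (hp | ⟨x, y, hp, rfl⟩) | ⟨x, y, ⟨hx, hy⟩, rfl⟩
    · exact hL p hp
    · simpa using hL _ hp
    · intro h
      apply hb
      simp only [Finset.mem_image, Finset.mem_product, Prod.exists]
      exact ⟨x, y, ⟨hx, hy⟩, mul_inv_eq_one.1 h⟩)
  have ha1 : ∀ p ∈ L, a * p.1 * a⁻¹ ≠ p.2 := fun p hp => ha p (by simp [L', hp])
  have ha2 : ∀ p ∈ L, a * b * p.1 * (a * b)⁻¹ ≠ p.2 := fun p hp h => by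
    refine ha (b * p.1 * b⁻¹, p.2) ?_ ?_
    · simp only [L', Finset.mem_union, Finset.mem_image]
      exact Or.inl (Or.inr ⟨p, hp, rfl⟩)
    · simpa [mul_assoc] using h
  by_cases h1 : ∀ f ∈ Φ, a * f * (a * f) ≠ 1
  · exact ⟨a, ha1, h1⟩
  by_cases h2 : ∀ f ∈ Φ, a * b * f * (a * b * f) ≠ 1
  · exact ⟨a * b, ha2, h2⟩
  push Not at h1 h2
  obtain ⟨f, hf, hf1⟩ := h1
  obtain ⟨f', hf', hf1'⟩ := h2
  refine (ha (f * f'⁻¹ * b⁻¹, f⁻¹ * (b * f')) ?_ ?_).elim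
  · simp only [L', Finset.mem_union, Finset.mem_image, Finset.mem_product, Prod.exists]
    exact Or.inr ⟨f, f', ⟨hf, hf'⟩, rfl⟩
  · have e1 : f * a * f = a⁻¹ := by
      rw [eq_comm, inv_eq_iff_mul_eq_one]
      simpa [mul_assoc] using hf1
    have e2 : b * f' * a * (b * f') = a⁻¹ := by
      rw [eq_comm, inv_eq_iff_mul_eq_one]
      simpa [mul_assoc] using hf1'
    have e3 : f * a * f = b * f' * a * (b * f') := e1.trans e2.symm
    calc a * (f * f'⁻¹ * b⁻¹) * a⁻¹ = f⁻¹ * (f * a * f) * (b * f')⁻¹ * a⁻¹ := by group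
      _ = f⁻¹ * (b * f' * a * (b * f')) * (b * f')⁻¹ * a⁻¹ := by rw [e3]
      _ = f⁻¹ * (b * f') := by group

/-- If `w x w = y` then `(w x)² = y x`, so `w x` commutes with `y x`. This is a conjugation equation
for `w` when `y x ≠ 1`, and otherwise says `(w x)² = 1`. The equation `w = x` is excluded by testing
conjugation on a fixed `z ≠ 1`. -/
theorem IsICC.exists_isFree [Nontrivial G] (hG : IsICC G) (Φ : Finset G) :
    ∃ w : G, IsFree Φ w := by
  classical
  obtain ⟨z, hz⟩ := exists_ne (1 : G)
  let L₁ : Finset (G × G) := (Φ ×ˢ Φ).filter (fun p => p.1 ≠ 1)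
  let L₂ : Finset (G × G) := Φ.image (fun x => (z, x * z * x⁻¹))
  let L₃ : Finset (G × G) := ((Φ ×ˢ Φ).filter (fun p => p.2 * p.1 ≠ 1)).image
    (fun p => (p.1 * (p.2 * p.1) * p.1⁻¹, p.2 * p.1))
  obtain ⟨w, hw, hw'⟩ := hG.exists_conj_ne_sq_ne (L₁ ∪ L₂ ∪ L₃) (by
    intro p hp
    simp only [L₁, L₂, L₃, Finset.mem_union, Finset.mem_image, Finset.mem_filter,
      Prod.exists] at hp
    rcases hp with (hp | ⟨x, _, rfl⟩) | ⟨x, y, ⟨_, hxy⟩, rfl⟩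
    · exact hp.2
    · exact hz
    · intro h
      apply hxy
      simpa using h) Φ
  have hmem₁ : ∀ p ∈ L₁, w * p.1 * w⁻¹ ≠ p.2 := fun p hp => hw p (by simp [hp])
  have hmem₂ : ∀ p ∈ L₂, w * p.1 * w⁻¹ ≠ p.2 := fun p hp => hw p (by simp [hp])
  have hmem₃ : ∀ p ∈ L₃, w * p.1 * w⁻¹ ≠ p.2 := fun p hp => hw p (by simp [hp])
  refine ⟨w, ?_, ?_, ?_⟩
  · rintro x hx rfl
    exact hmem₂ (z, w * z * w⁻¹) (Finset.mem_image_of_mem _ hx) rfl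
  · intro x hx hx1 y hy
    exact hmem₁ (x, y) (by simp [L₁, hx, hy, hx1])
  · intro x hx y hy h
    by_cases hyx : y * x = 1
    · exact hw' x hx (by rw [← hyx, ← h]; group)
    · refine hmem₃ (x * (y * x) * x⁻¹, y * x) ?_ ?_
      · exact Finset.mem_image.2 ⟨(x, y), by simp [hx, hy, hyx], rfl⟩
      · rw [← h]
        group

end Generic

end GenericShifts

/-! ### Spaced sets built from free elements, and pools of such elements. -/

namespace GenericShifts

section Pieces

open scoped Pointwise

variable {G : Type*} [Group G]

/-- A set is `K`-spaced if no two of its distinct elements differ by an element of `K`. -/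
def IsSpaced (K P : Set G) : Prop :=
  ∀ p ∈ P, ∀ p' ∈ P, p⁻¹ * p' ∈ K → p = p'

theorem IsSpaced.mono {K P Q : Set G} (hQ : IsSpaced K Q) (h : P ⊆ Q) : IsSpaced K P :=
  fun p hp p' hp' hk => hQ p (h hp) p' (h hp') hk

theorem isSpaced_singleton (K : Set G) (a : G) : IsSpaced K {a} := by
  rintro _ rfl _ rfl _
  rfl

section Words

variable [DecidableEq G]

/-- The products of at most four elements that lie, up to inversion, in `L`. -/
def words (L : Finset G) : Finset G :=
  insert 1 (L ∪ L⁻¹) * insert 1 (L ∪ L⁻¹) * insert 1 (L ∪ L⁻¹) * insert 1 (L ∪ L⁻¹)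

theorem mul_mem_words {L : Finset G} {a b c d : G} (ha : a ∈ insert 1 (L ∪ L⁻¹))
    (hb : b ∈ insert 1 (L ∪ L⁻¹)) (hc : c ∈ insert 1 (L ∪ L⁻¹))
    (hd : d ∈ insert 1 (L ∪ L⁻¹)) : a * b * c * d ∈ words L :=
  Finset.mul_mem_mul (Finset.mul_mem_mul (Finset.mul_mem_mul ha hb) hc) hd

theorem mem_letters {L : Finset G} {a : G} (ha : a ∈ L) : a ∈ insert 1 (L ∪ L⁻¹) := by
  simp [ha]

theorem inv_mem_letters {L : Finset G} {a : G} (ha : a ∈ L) : a⁻¹ ∈ insert 1 (L ∪ L⁻¹) := by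
  simp [ha]

theorem one_mem_letters {L : Finset G} : (1 : G) ∈ insert 1 (L ∪ L⁻¹) := by
  simp

theorem mul_mem_words₂ {L : Finset G} {a b : G} (ha : a ∈ insert 1 (L ∪ L⁻¹))
    (hb : b ∈ insert 1 (L ∪ L⁻¹)) : a * b ∈ words L := by
  simpa using mul_mem_words ha hb one_mem_letters one_mem_letters

theorem mul_mem_words₃ {L : Finset G} {a b c : G} (ha : a ∈ insert 1 (L ∪ L⁻¹))
    (hb : b ∈ insert 1 (L ∪ L⁻¹)) (hc : c ∈ insert 1 (L ∪ L⁻¹)) : a * b * c ∈ words L := by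
  simpa using mul_mem_words ha hb hc one_mem_letters

theorem subset_words (L : Finset G) : L ⊆ words L := fun a ha => by
  simpa using mul_mem_words (mem_letters ha) one_mem_letters one_mem_letters one_mem_letters

/-- A collision between two points is an equation in `w` of degree at most two with coefficients in
`words L`. Freeness forbids it unless `w` cancels in a conjugation of `1`; then spacing of the right
factor `Y` or `Y'` identifies the points. The left factors `X`, `X'` need no spacing, which is what
makes the construction flexible. -/
theorem IsFree.isSpaced {L : Finset G} {w : G} (hw : IsFree (words L) w)
    {K S X Y X' Y' : Finset G} (hK : K ⊆ L) (hS : S ⊆ L) (hX : X ⊆ L) (hY : Y ⊆ L)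
    (hX' : X' ⊆ L) (hY' : Y' ⊆ L) (hSK : IsSpaced (K : Set G) S)
    (hYK : IsSpaced (K : Set G) Y) (hYK' : IsSpaced (K : Set G) Y') :
    IsSpaced (K : Set G) ((S ∪ X * {w} * Y ∪ X' * {w⁻¹} * Y' : Finset G) : Set G) := by
  have key : ∀ p, p ∈ (S ∪ X * {w} * Y ∪ X' * {w⁻¹} * Y' : Finset G) → p ∈ S ∨
      (∃ x ∈ X, ∃ y ∈ Y, p = x * w * y) ∨ ∃ x ∈ X', ∃ y ∈ Y', p = x * w⁻¹ * y := by
    intro p hp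
    rw [Finset.mem_union, Finset.mem_union] at hp
    rcases hp with (hp | hp) | hp
    · exact Or.inl hp
    · obtain ⟨z, hz, y, hy, rfl⟩ := Finset.mem_mul.1 hp
      obtain ⟨x, hx, v, hv, rfl⟩ := Finset.mem_mul.1 hz
      rw [Finset.mem_singleton.1 hv]
      exact Or.inr (Or.inl ⟨x, hx, y, hy, rfl⟩)
    · obtain ⟨z, hz, y, hy, rfl⟩ := Finset.mem_mul.1 hp
      obtain ⟨x, hx, v, hv, rfl⟩ := Finset.mem_mul.1 hz
      rw [Finset.mem_singleton.1 hv]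
      exact Or.inr (Or.inr ⟨x, hx, y, hy, rfl⟩)
  intro p hp p' hp' hk
  obtain ⟨κ, hκ, hκe⟩ : ∃ κ ∈ K, p' = p * κ := ⟨p⁻¹ * p', hk, by group⟩
  have hκL := hK hκ
  rcases key p hp with hs | ⟨x, hx, y, hy, rfl⟩ | ⟨x, hx, y, hy, rfl⟩ <;>
    rcases key p' hp' with hs' | ⟨x', hx', y', hy', rfl⟩ | ⟨x', hx', y', hy', rfl⟩
  · exact hSK p hs p' hs' hk
  · refine (hw.ne (x'⁻¹ * p * κ * y'⁻¹) (mul_mem_words (inv_mem_letters (hX hx'))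
      (mem_letters (hS hs)) (mem_letters hκL) (inv_mem_letters (hY hy'))) ?_).elim
    rw [mul_assoc x'⁻¹, ← hκe]; group
  · refine (hw.ne (y' * κ⁻¹ * p⁻¹ * x') (mul_mem_words (mem_letters (hY' hy'))
      (inv_mem_letters hκL) (inv_mem_letters (hS hs)) (mem_letters (hX' hx'))) ?_).elim
    rw [mul_assoc y', ← mul_inv_rev, ← hκe]; group
  · refine (hw.ne (x⁻¹ * p' * κ⁻¹ * y⁻¹) (mul_mem_words (inv_mem_letters (hX hx))
      (mem_letters (hS hs')) (inv_mem_letters hκL) (inv_mem_letters (hY hy))) ?_).elim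
    rw [hκe]; group
  · have hconj : w * (y * κ * y'⁻¹) * w⁻¹ = x⁻¹ * x' := by
      rw [show y'⁻¹ = (x' * w * y')⁻¹ * x' * w by group, hκe]; group
    by_cases h1 : y * κ * y'⁻¹ = 1
    · have hyy : y = y' := hYK y hy y' hy' (by
        rw [← mul_inv_eq_one.1 h1]; simpa using hκ)
      rw [h1] at hconj
      have : x = x' := by simpa [inv_mul_eq_one, eq_comm] using hconj
      rw [hyy, this]
    · exact (hw.conj_ne _ (mul_mem_words₃ (mem_letters (hY hy)) (mem_letters hκL)
        (inv_mem_letters (hY hy'))) h1 _ (mul_mem_words₂ (inv_mem_letters (hX hx))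
        (mem_letters (hX hx'))) hconj).elim
  · refine (hw.sq_ne _ (mul_mem_words₃ (mem_letters (hY hy)) (mem_letters hκL)
      (inv_mem_letters (hY' hy'))) _ (mul_mem_words₂ (inv_mem_letters (hX hx))
      (mem_letters (hX' hx'))) ?_).elim
    rw [show y'⁻¹ = (x' * w⁻¹ * y')⁻¹ * x' * w⁻¹ by group, hκe]; group
  · refine (hw.ne (y * κ * p'⁻¹ * x) (mul_mem_words (mem_letters (hY' hy))
      (mem_letters hκL) (inv_mem_letters (hS hs')) (mem_letters (hX' hx))) ?_).elim
    rw [hκe]; group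
  · refine (hw.sq_ne _ (mul_mem_words₂ (inv_mem_letters (hX' hx)) (mem_letters (hX hx'))) _
      (mul_mem_words₃ (mem_letters (hY' hy)) (mem_letters hκL)
      (inv_mem_letters (hY hy'))) ?_).elim
    rw [show y'⁻¹ = (x' * w * y')⁻¹ * x' * w by group, hκe]; group
  · have hconj : w * (x⁻¹ * x') * w⁻¹ = y * κ * y'⁻¹ := by
      rw [show y'⁻¹ = (x' * w⁻¹ * y')⁻¹ * x' * w⁻¹ by group, hκe]; group
    by_cases h1 : x⁻¹ * x' = 1
    · have hyy : y = y' := hYK' y hy y' hy' (by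
        rw [h1] at hconj
        have : y * κ = y' := mul_inv_eq_one.1 (by simpa using hconj.symm)
        rw [← this]; simpa using hκ)
      rw [hyy, inv_mul_eq_one.1 h1]
    · exact (hw.conj_ne _ (mul_mem_words₂ (inv_mem_letters (hX' hx)) (mem_letters (hX' hx'))) h1
        _ (mul_mem_words₃ (mem_letters (hY' hy)) (mem_letters hκL)
        (inv_mem_letters (hY' hy'))) hconj).elim

end Words

/-- Arbitrarily large pools of free elements at which the conjugates of each `k ∈ K` differ. -/
theorem IsICC.exists_pool [Nontrivial G] (hG : IsICC G) (Φ K : Finset G) (n : ℕ) :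
    ∃ R : Finset G, R.card = n ∧ (∀ r ∈ R, IsFree Φ r) ∧
      ∀ k ∈ K, k ≠ 1 → ∀ r ∈ R, ∀ r' ∈ R, r * k * r⁻¹ = r' * k * r'⁻¹ → r = r' := by
  classical
  induction n with
  | zero => exact ⟨∅, by simp⟩
  | succ n ih =>
    obtain ⟨R, hcard, hfree, hinj⟩ := ih
    obtain ⟨w, hw⟩ := hG.exists_isFree
      (Φ ∪ K ∪ R ∪ (R ×ˢ K).image fun p => p.1 * p.2 * p.1⁻¹)
    have hne : ∀ k ∈ K, k ≠ 1 → ∀ r ∈ R, w * k * w⁻¹ ≠ r * k * r⁻¹ := fun k hk hk1 r hr =>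
      hw.conj_ne k (by simp [hk]) hk1 _ (by
        rw [Finset.mem_union, Finset.mem_image]
        exact Or.inr ⟨(r, k), by simp [hr, hk], rfl⟩)
    refine ⟨insert w R, ?_, ?_, ?_⟩
    · rw [Finset.card_insert_of_notMem, hcard]
      exact fun h => hw.ne w (by simp [h]) rfl
    · intro r hr
      rcases Finset.mem_insert.1 hr with rfl | hr
      · exact hw.mono (by intro x hx; simp [hx])
      · exact hfree r hr
    · intro k hk hk1 r hr r' hr' h
      rcases Finset.mem_insert.1 hr with h₁ | h₁ <;> rcases Finset.mem_insert.1 hr' with h₂ | h₂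
      · exact h₁.trans h₂.symm
      · exact (hne k hk hk1 r' h₂ (h₁ ▸ h)).elim
      · exact (hne k hk hk1 r h₁ (h₂ ▸ h).symm).elim
      · exact hinj k hk hk1 r h₁ r' h₂ h

/-- Pigeonhole: each condition excludes at most one element. -/
theorem exists_forall_not_of_subsingleton {α ι : Type*} (R : Finset α) (I : Finset ι)
    (p : ι → α → Prop) (hp : ∀ i ∈ I, ∀ r ∈ R, ∀ r' ∈ R, p i r → p i r' → r = r')
    (hcard : I.card < R.card) : ∃ r ∈ R, ∀ i ∈ I, ¬ p i r := by
  by_contra! h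
  obtain ⟨r₀, hr₀⟩ := Finset.card_pos.1 (Nat.zero_lt_of_lt hcard)
  have : Nonempty ι := ⟨(h r₀ hr₀).choose⟩
  choose! f hfI hf using h
  refine absurd (Finset.card_le_card_of_injOn (s := R) (t := I) f (fun r hr => hfI r hr)
    fun r hr r' hr' he => ?_) (by omega)
  exact hp _ (hfI r hr) r hr r' hr' (hf r hr) (he ▸ hf r' hr')

end Pieces

end GenericShifts

/-! ### The three-point set `P` and a spaced set hitting its close translates. -/

namespace GenericShifts

section Pieces

open scoped Pointwise

variable {G : Type*} [Group G]

theorem IsFree.isSpaced_one_mul_union [DecidableEq G] {K : Finset G} {r : G}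
    (h1K : (1 : G) ∈ K) (hr : IsFree (words K) r) :
    IsSpaced (K : Set G) (({1} ∪ K * {r} ∪ K * {r⁻¹} : Finset G) : Set G) := by
  have h1 : ({1} : Finset G) ⊆ K := Finset.singleton_subset_iff.2 h1K
  have hs : IsSpaced (K : Set G) (({1} : Finset G) : Set G) := by
    rw [Finset.coe_singleton]
    exact isSpaced_singleton _ _
  have h := hr.isSpaced subset_rfl h1 subset_rfl h1 subset_rfl h1 hs hs hs
  refine h.mono ?_
  intro x hx
  rw [Finset.mem_coe, Finset.mem_union, Finset.mem_union] at hx ⊢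
  rcases hx with (hx | hx) | hx
  · exact Or.inl (Or.inl hx)
  · exact Or.inl (Or.inr (by simpa using Finset.mul_mem_mul hx (Finset.mem_singleton_self (1 : G))))
  · exact Or.inr (by simpa using Finset.mul_mem_mul hx (Finset.mem_singleton_self (1 : G)))

/-- The five words that are obstructed by conjugates `q k q⁻¹`. -/
def obstructedWord (q k r : G) : Fin 5 → G :=
  ![r * k * q, k * r⁻¹ * q, r * k * r⁻¹ * q, k * q⁻¹ * r, r * k * q⁻¹]

/-- For fixed `i`, `k`, `k'`, `κ` the equation determines `r`, or, when `i = 2`, the conjugate `r *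
k' * r⁻¹`, which determines `r` within the pool if `k' ≠ 1`. So at most `5 |K|³` elements of the
pool are lost. -/
theorem exists_obstructedWord_ne {K R : Finset G}
    (hinj : ∀ k ∈ K, k ≠ 1 → ∀ r ∈ R, ∀ r' ∈ R, r * k * r⁻¹ = r' * k * r'⁻¹ → r = r')
    (hcard : 5 * (K.card * K.card * K.card) < R.card) (q : G) :
    ∃ r ∈ R, ∀ k ∈ K, ∀ k' ∈ K, ∀ κ ∈ K, ∀ i : Fin 5, (i = 2 → k' ≠ 1) →
      q * k * q⁻¹ * obstructedWord q k' r i ≠ κ := by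
  classical
  obtain ⟨r, hr, h⟩ := exists_forall_not_of_subsingleton R
    (Finset.univ ×ˢ (K ×ˢ K ×ˢ K) : Finset (Fin 5 × G × G × G))
    (fun p r => (p.1 = 2 → p.2.2.1 ≠ 1) ∧
      q * p.2.1 * q⁻¹ * obstructedWord q p.2.2.1 r p.1 = p.2.2.2)
    (by
      rintro ⟨i, k, k', κ⟩ hi r hr r' hr' ⟨h₁, h₂⟩ ⟨-, h₃⟩
      simp only [Finset.mem_product, Finset.mem_univ, true_and] at hi
      have h₄ := mul_left_cancel (h₂.trans h₃.symm)
      fin_cases i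
      · simpa [obstructedWord] using h₄
      · simpa [obstructedWord] using h₄
      · exact hinj k' hi.2.1 (h₁ rfl) r hr r' hr' (by simpa [obstructedWord] using h₄)
      · simpa [obstructedWord] using h₄
      · simpa [obstructedWord] using h₄)
    (by simpa [Finset.card_product, mul_assoc] using hcard)
  exact ⟨r, hr, fun k hk k' hk' κ hκ i hi h' =>
    h (i, k, k', κ) (by simp [hk, hk', hκ]) ⟨hi, h'⟩⟩

/-- In an ICC group there are a finite `K`-spaced set `P` and a finite `K`-spaced set that meets
each of the translates of `P` that come `K`-close to `P`. -/
theorem IsICC.exists_spaced_hitting [Nontrivial G] (hG : IsICC G) (K : Finset G)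
    (h1K : (1 : G) ∈ K) (hKinv : ∀ k ∈ K, k⁻¹ ∈ K) :
    ∃ P A : Finset G, P.Nonempty ∧ IsSpaced (K : Set G) P ∧ IsSpaced (K : Set G) A ∧
      ∀ a ∈ P, ∀ k ∈ K, ∀ b ∈ P, ∃ l ∈ P, a * k * b⁻¹ * l ∈ A := by
  classical
  obtain ⟨R, hcard, hfree, hinj⟩ := hG.exists_pool (words K) K (5 * (K.card * K.card * K.card) + 1)
  let B : Finset G := insert 1 (K ∪ R ∪ R⁻¹)
  let L : Finset G := B * B * B
  -- The order matters: `q` is free over the whole pool, and only then is `r` picked from the pool,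
  -- depending on `q`.
  obtain ⟨q, hq⟩ := hG.exists_isFree (words L)
  obtain ⟨r, hrR, hr⟩ := exists_obstructedWord_ne hinj (by omega) q
  have hrfree := hfree r hrR
  have mem3 : ∀ {a b c : G}, a ∈ B → b ∈ B → c ∈ B → a * b * c ∈ L := fun ha hb hc =>
    Finset.mul_mem_mul (Finset.mul_mem_mul ha hb) hc
  have h1B : (1 : G) ∈ B := by simp [B]
  have hKB : ∀ {k}, k ∈ K → k ∈ B := fun hk => by simp [B, hk]
  have hrB : r ∈ B := by simp [B, hrR]
  have hrB' : r⁻¹ ∈ B := by simp [B, hrR]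
  have mem2 : ∀ {a b : G}, a ∈ B → b ∈ B → a * b ∈ L := fun ha hb => by
    simpa using mem3 ha hb h1B
  have mem1 : ∀ {a : G}, a ∈ B → a ∈ L := fun ha => by simpa using mem2 ha h1B
  have hKL : K ⊆ L := fun k hk => mem1 (hKB hk)
  have hY := hrfree.isSpaced_one_mul_union h1K
  have h1r : IsSpaced (K : Set G) (({1, r} : Finset G) : Set G) := hY.mono (by
    intro x hx
    simp only [Finset.coe_insert, Finset.coe_singleton, Set.mem_insert_iff,
      Set.mem_singleton_iff] at hx
    rcases hx with rfl | rfl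
    · simp
    · simp [h1K])
  let S : Finset G := K * {r}
  let X₀ : Finset G := {r} * K ∪ K * {r⁻¹} ∪ {r} * K * {r⁻¹}
  let Y : Finset G := {1} ∪ K * {r} ∪ K * {r⁻¹}
  let X' : Finset G := K ∪ {r} * K
  have memKr : ∀ {T : Finset G} {x a : G}, x ∈ T * {a} → ∃ k ∈ T, x = k * a := by
    intro T x a hx
    obtain ⟨k, hk, b, hb, rfl⟩ := Finset.mem_mul.1 hx
    exact ⟨k, hk, by rw [Finset.mem_singleton.1 hb]⟩
  have memrK : ∀ {T : Finset G} {x a : G}, x ∈ {a} * T → ∃ k ∈ T, x = a * k := by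
    intro T x a hx
    obtain ⟨b, hb, k, hk, rfl⟩ := Finset.mem_mul.1 hx
    exact ⟨k, hk, by rw [Finset.mem_singleton.1 hb]⟩
  have memX₀ : ∀ {x}, x ∈ X₀ → (∃ k ∈ K, x = r * k) ∨ (∃ k ∈ K, x = k * r⁻¹) ∨
      ∃ k ∈ K, x = r * k * r⁻¹ := by
    intro x hx
    rcases Finset.mem_union.1 hx with hx | hx
    · rcases Finset.mem_union.1 hx with hx | hx
      · exact Or.inl (memrK hx)
      · exact Or.inr (Or.inl (memKr hx))
    · obtain ⟨y, hy, rfl⟩ := memKr hx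
      obtain ⟨k, hk, rfl⟩ := memrK hy
      exact Or.inr (Or.inr ⟨k, hk, rfl⟩)
  -- An enlargement of `A₁` below, in the product form required by `IsFree.isSpaced`.
  let A₀ : Finset G := S ∪ ({1} ∪ X₀) * {q} * Y ∪ X' * {q⁻¹} * {1, r}
  have hA₀ : IsSpaced (K : Set G) A₀ := by
    refine hq.isSpaced hKL ?_ ?_ ?_ ?_ ?_ (hY.mono ?_) hY h1r
    · intro x hx
      obtain ⟨k, hk, rfl⟩ := memKr hx
      exact mem2 (hKB hk) hrB
    · intro x hx
      rcases Finset.mem_union.1 hx with hx | hx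
      · rw [Finset.mem_singleton.1 hx]
        exact mem1 h1B
      · rcases memX₀ hx with ⟨k, hk, rfl⟩ | ⟨k, hk, rfl⟩ | ⟨k, hk, rfl⟩
        · exact mem2 hrB (hKB hk)
        · exact mem2 (hKB hk) hrB'
        · exact mem3 hrB (hKB hk) hrB'
    · intro x hx
      rcases Finset.mem_union.1 hx with hx | hx
      · rcases Finset.mem_union.1 hx with hx | hx
        · rw [Finset.mem_singleton.1 hx]
          exact mem1 h1B
        · obtain ⟨k, hk, rfl⟩ := memKr hx
          exact mem2 (hKB hk) hrB
      · obtain ⟨k, hk, rfl⟩ := memKr hx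
        exact mem2 (hKB hk) hrB'
    · intro x hx
      rcases Finset.mem_union.1 hx with hx | hx
      · exact hKL hx
      · obtain ⟨k, hk, rfl⟩ := memrK hx
        exact mem2 hrB (hKB hk)
    · intro x hx
      rcases Finset.mem_insert.1 hx with rfl | hx
      · exact mem1 h1B
      · rw [Finset.mem_singleton.1 hx]
        exact mem1 hrB
    · exact Finset.coe_subset.2
        (Finset.subset_union_right.trans Finset.subset_union_left)
  -- The products `a * k * b⁻¹ * l` for all pairs `(a, b)` except `(q, q)`, which contributes `D`.
  let A₁ : Finset G := K * {r} ∪ X₀ * {q} ∪ {q} * (K * {r} ∪ K * {r⁻¹}) ∪ K * {q⁻¹ * r} ∪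
    {r} * K * {q⁻¹}
  let D : Finset G := {q} * K * {q⁻¹}
  have memA₁ : ∀ {x}, x ∈ A₁ → (∃ k ∈ K, x = k * r) ∨ (∃ y ∈ X₀, x = y * q) ∨
      (∃ k ∈ K, x = q * (k * r)) ∨ (∃ k ∈ K, x = q * (k * r⁻¹)) ∨
      (∃ k ∈ K, x = k * (q⁻¹ * r)) ∨ (∃ k ∈ K, x = r * k * q⁻¹) := by
    intro x hx
    rcases Finset.mem_union.1 hx with hx | hx
    · rcases Finset.mem_union.1 hx with hx | hx
      · rcases Finset.mem_union.1 hx with hx | hx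
        · rcases Finset.mem_union.1 hx with hx | hx
          · exact Or.inl (memKr hx)
          · exact Or.inr (Or.inl (memKr hx))
        · obtain ⟨y, hy, rfl⟩ := memrK hx
          rcases Finset.mem_union.1 hy with hy | hy
          · obtain ⟨k, hk, rfl⟩ := memKr hy
            exact Or.inr (Or.inr (Or.inl ⟨k, hk, rfl⟩))
          · obtain ⟨k, hk, rfl⟩ := memKr hy
            exact Or.inr (Or.inr (Or.inr (Or.inl ⟨k, hk, rfl⟩)))
      · exact Or.inr (Or.inr (Or.inr (Or.inr (Or.inl (memKr hx)))))
    · obtain ⟨y, hy, rfl⟩ := memKr hx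
      obtain ⟨k, hk, rfl⟩ := memrK hy
      exact Or.inr (Or.inr (Or.inr (Or.inr (Or.inr ⟨k, hk, rfl⟩))))
  have memD : ∀ {x}, x ∈ D → ∃ k ∈ K, x = q * k * q⁻¹ := by
    intro x hx
    obtain ⟨y, hy, rfl⟩ := memKr hx
    obtain ⟨k, hk, rfl⟩ := memrK hy
    exact ⟨k, hk, rfl⟩
  have inA₀q : ∀ {x y}, x ∈ ({1} ∪ X₀ : Finset G) → y ∈ Y → x * q * y ∈ A₀ := fun hx hy =>
    Finset.mem_union_left _ (Finset.mem_union_right _ (Finset.mul_mem_mul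
      (Finset.mul_mem_mul hx (Finset.mem_singleton_self q)) hy))
  have inA₀q' : ∀ {x y}, x ∈ X' → y ∈ ({1, r} : Finset G) → x * q⁻¹ * y ∈ A₀ := fun hx hy =>
    Finset.mem_union_right _ (Finset.mul_mem_mul
      (Finset.mul_mem_mul hx (Finset.mem_singleton_self q⁻¹)) hy)
  have hA₁ : IsSpaced (K : Set G) A₁ := hA₀.mono (by
    intro x hx
    rw [Finset.mem_coe]
    rcases memA₁ hx with ⟨k, hk, rfl⟩ | ⟨y, hy, rfl⟩ | ⟨k, hk, rfl⟩ | ⟨k, hk, rfl⟩ |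
      ⟨k, hk, rfl⟩ | ⟨k, hk, rfl⟩
    · exact Finset.mem_union_left _ (Finset.mem_union_left _
        (Finset.mul_mem_mul hk (Finset.mem_singleton_self r)))
    · simpa using inA₀q (Finset.mem_union_right {1} hy)
        (Finset.mem_union_left _ (Finset.mem_union_left _ (Finset.mem_singleton_self (1 : G))))
    · simpa using inA₀q (Finset.mem_union_left X₀ (Finset.mem_singleton_self (1 : G)))
        (Finset.mem_union_left _ (Finset.mem_union_right _
          (Finset.mul_mem_mul hk (Finset.mem_singleton_self r))))
    · simpa using inA₀q (Finset.mem_union_left X₀ (Finset.mem_singleton_self (1 : G)))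
        (Finset.mem_union_right _ (Finset.mul_mem_mul hk (Finset.mem_singleton_self r⁻¹)))
    · rw [← mul_assoc]
      exact inA₀q' (Finset.mem_union_left _ hk) (by simp)
    · simpa using inA₀q' (Finset.mem_union_right K
        (Finset.mul_mem_mul (Finset.mem_singleton_self r) hk)) (Finset.mem_insert_self 1 {r}))
  have hD : IsSpaced (K : Set G) D := by
    intro p hp p' hp' hκ
    obtain ⟨k, hk, rfl⟩ := memD hp
    obtain ⟨k', hk', rfl⟩ := memD hp'
    by_cases h1 : k⁻¹ * k' = 1
    · rw [inv_mul_eq_one.1 h1]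
    · refine (hq.conj_ne _ (mul_mem_words₂ (inv_mem_letters (hKL hk)) (mem_letters (hKL hk'))) h1
        _ (subset_words L (hKL hκ)) ?_).elim
      group
  -- Up to three occurrences of `q` appear here, beyond the reach of freeness; those words are the
  -- ones avoided by the choice of `r`.
  have hcross : ∀ k ∈ K, ∀ a ∈ A₁, q * k * q⁻¹ * a ∉ K := by
    intro k hk a ha hκ
    rcases memA₁ ha with ⟨k', hk', rfl⟩ | ⟨y, hy, rfl⟩ | ⟨k', hk', rfl⟩ | ⟨k', hk', rfl⟩ |
      ⟨k', hk', rfl⟩ | ⟨k', hk', rfl⟩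
    · by_cases h1 : k = 1
      · subst h1
        refine hrfree.ne _ (mul_mem_words₂ (inv_mem_letters hk') (mem_letters hκ)) ?_
        group
      · refine hq.conj_ne k (subset_words L (hKL hk)) h1
          _ (mul_mem_words₃ (mem_letters (hKL hκ)) (inv_mem_letters (mem1 hrB))
            (inv_mem_letters (hKL hk'))) ?_
        group
    · rcases memX₀ hy with ⟨k', hk', rfl⟩ | ⟨k', hk', rfl⟩ | ⟨k', hk', rfl⟩
      · exact hr k hk k' hk' _ hκ 0 (by simp) rfl
      · exact hr k hk k' hk' _ hκ 1 (by simp) rfl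
      · by_cases h1 : k' = 1
        · subst h1
          refine hq.ne _ (mul_mem_words₂ (mem_letters (hKL hκ)) (inv_mem_letters (hKL hk))) ?_
          group
        · exact hr k hk k' hk' _ hκ 2 (fun _ => h1) rfl
    · refine hq.ne _ (mul_mem_words (mem_letters (hKL hκ)) (inv_mem_letters (mem1 hrB))
        (inv_mem_letters (hKL hk')) (inv_mem_letters (hKL hk))) ?_
      group
    · refine hq.ne _ (mul_mem_words (mem_letters (hKL hκ)) (mem_letters (mem1 hrB))
        (inv_mem_letters (hKL hk')) (inv_mem_letters (hKL hk))) ?_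
      group
    · refine hr k hk k' hk' _ hκ 3 (by simp) ?_
      simp [obstructedWord, mul_assoc]
    · exact hr k hk k' hk' _ hκ 4 (by simp) rfl
  have inD : ∀ {k}, k ∈ K → q * k * q⁻¹ ∈ D := fun hk => Finset.mul_mem_mul
    (Finset.mul_mem_mul (Finset.mem_singleton_self q) hk) (Finset.mem_singleton_self q⁻¹)
  have inX₀q : ∀ {x}, x ∈ X₀ → x * q ∈ A₁ := fun hx => by
    have := Finset.mul_mem_mul hx (Finset.mem_singleton_self q)
    simp only [A₁, Finset.mem_union]
    exact Or.inl (Or.inl (Or.inl (Or.inr this)))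
  have inqK : ∀ {x}, x ∈ K * {r} ∪ K * {r⁻¹} → q * x ∈ A₁ := fun hx => by
    have := Finset.mul_mem_mul (Finset.mem_singleton_self q) hx
    rw [Finset.mem_union] at hx
    simp only [A₁, Finset.mem_union]
    exact Or.inl (Or.inl (Or.inr this))
  have insing : ∀ {T : Finset G} {k a : G}, k ∈ T → k * a ∈ T * {a} := fun hk =>
    Finset.mul_mem_mul hk (Finset.mem_singleton_self _)
  have inrK : ∀ {k}, k ∈ K → r * k ∈ ({r} * K : Finset G) := fun hk =>
    Finset.mul_mem_mul (Finset.mem_singleton_self r) hk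
  refine ⟨{1, r, q}, A₁ ∪ D, Finset.insert_nonempty _ _, ?_, ?_, ?_⟩
  · have hL1 : ∀ {x}, x ∈ ({1, r} : Finset G) → x ∈ L := by
      intro x hx
      rcases Finset.mem_insert.1 hx with rfl | hx
      · exact mem1 h1B
      · rw [Finset.mem_singleton.1 hx]
        exact mem1 hrB
    have hs : IsSpaced (K : Set G) (({1} : Finset G) : Set G) := by
      rw [Finset.coe_singleton]
      exact isSpaced_singleton _ _
    have h1L : ({1} : Finset G) ⊆ L := Finset.singleton_subset_iff.2 (mem1 h1B)
    refine (hq.isSpaced hKL (fun x hx => hL1 hx) h1L h1L h1L h1L h1r hs hs).mono ?_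
    intro x hx
    simp only [Finset.coe_insert, Finset.coe_singleton, Set.mem_insert_iff,
      Set.mem_singleton_iff] at hx
    rcases hx with rfl | rfl | rfl <;> simp
  · intro p hp p' hp' hk
    rcases Finset.mem_union.1 hp with h₁ | h₁ <;> rcases Finset.mem_union.1 hp' with h₂ | h₂
    · exact hA₁ p h₁ p' h₂ hk
    · obtain ⟨k, hkK, rfl⟩ := memD h₂
      refine (hcross k⁻¹ (hKinv k hkK) p h₁ ?_).elim
      have := hKinv _ hk
      simpa [mul_assoc] using this
    · obtain ⟨k, hkK, rfl⟩ := memD h₁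
      refine (hcross k⁻¹ (hKinv k hkK) p' h₂ ?_).elim
      simpa [mul_assoc] using hk
    · exact hD p h₁ p' h₂ hk
  -- For `a ≠ b` the witness `l` is the third point of `P`; for `a = b` it follows the cycle `1 ↦ r
  -- ↦ q ↦ 1`.
  · have h1 : (1 : G) ∈ ({1, r, q} : Finset G) := by simp
    have h2 : r ∈ ({1, r, q} : Finset G) := by simp
    have h3 : q ∈ ({1, r, q} : Finset G) := by simp
    intro a ha k hk b hb
    simp only [Finset.mem_insert, Finset.mem_singleton] at ha hb
    rcases ha with rfl | rfl | rfl <;> rcases hb with rfl | rfl | rfl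
    · refine ⟨r, h2, Finset.mem_union_left _ ?_⟩
      have := insing (a := r) hk
      simp only [A₁, Finset.mem_union]
      exact Or.inl (Or.inl (Or.inl (Or.inl (by simpa using this))))
    · refine ⟨q, h3, Finset.mem_union_left _ (inX₀q ?_)⟩
      simp only [X₀, Finset.mem_union]
      exact Or.inl (Or.inr (by simpa using insing (a := b⁻¹) hk))
    · refine ⟨r, h2, Finset.mem_union_left _ ?_⟩
      have := insing (a := b⁻¹ * r) hk
      simp only [A₁, Finset.mem_union]
      exact Or.inl (Or.inr (by simpa [mul_assoc] using this))
    · refine ⟨q, h3, Finset.mem_union_left _ (inX₀q ?_)⟩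
      simp only [X₀, Finset.mem_union]
      exact Or.inl (Or.inl (by simpa using inrK hk))
    · refine ⟨q, h3, Finset.mem_union_left _ (inX₀q ?_)⟩
      simp only [X₀, Finset.mem_union]
      exact Or.inr (insing (inrK hk))
    · refine ⟨1, h1, Finset.mem_union_left _ ?_⟩
      have := insing (a := b⁻¹) (inrK hk)
      simp only [A₁, Finset.mem_union]
      exact Or.inr (by simpa using this)
    · refine ⟨r, h2, Finset.mem_union_left _ ?_⟩
      simpa [mul_assoc] using inqK (Finset.mem_union_left _ (insing (a := r) hk))
    · refine ⟨1, h1, Finset.mem_union_left _ ?_⟩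
      simpa [mul_assoc] using inqK (Finset.mem_union_right _ (insing (a := b⁻¹) hk))
    · exact ⟨1, h1, Finset.mem_union_right _ (by simpa using inD hk)⟩

end Pieces

end GenericShifts

/-! ### Enlarging the hitting set so that it also hits its own translates. -/

namespace GenericShifts

section Pieces

open scoped Pointwise

variable {G : Type*} [Group G]

/-- In an ICC group there are finite `K`-spaced sets `P` and `Q` such that `Q` meets the translates
of `P` that come `K`-close to `P`, and also the translates of `Q` that come `K`-close to `P`. -/
theorem IsICC.exists_spaced_pair [Nontrivial G] (hG : IsICC G) (K : Finset G)
    (h1K : (1 : G) ∈ K) (hKinv : ∀ k ∈ K, k⁻¹ ∈ K) :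
    ∃ P Q : Finset G, P.Nonempty ∧ IsSpaced (K : Set G) P ∧ IsSpaced (K : Set G) Q ∧
      (∀ a ∈ P, ∀ k ∈ K, ∀ b ∈ P, ∃ l ∈ P, a * k * b⁻¹ * l ∈ Q) ∧
      ∀ a ∈ P, ∀ k ∈ K, ∀ b ∈ Q, ∃ l ∈ Q, a * k * b⁻¹ * l ∈ Q := by
  classical
  obtain ⟨P, A, hPne, hP, hA, hPA⟩ := hG.exists_spaced_hitting K h1K hKinv
  let L : Finset G := {1} ∪ K ∪ A ∪ P * K
  have h1L : ({1} : Finset G) ⊆ L := by intro x hx; simp [L, Finset.mem_singleton.1 hx]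
  have hKL : K ⊆ L := by intro x hx; simp [L, hx]
  have hAL : A ⊆ L := by intro x hx; simp [L, hx]
  have hPKL : P * K ⊆ L := Finset.subset_union_right
  obtain ⟨u, hu⟩ := hG.exists_isFree (words L)
  have hs : IsSpaced (K : Set G) (({1} : Finset G) : Set G) := by
    rw [Finset.coe_singleton]
    exact isSpaced_singleton _ _
  let S : Finset G := A ∪ P * K * {u} * {1} ∪ P * K * {u⁻¹} * {1}
  have hS : IsSpaced (K : Set G) S := hu.isSpaced hKL hAL hPKL h1L hPKL h1L hA hs hs
  have h1u : IsSpaced (K : Set G) (({1, u} : Finset G) : Set G) := by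
    refine (hu.isSpaced hKL h1L h1L h1L h1L h1L hs hs hs).mono ?_
    intro x hx
    simp only [Finset.coe_insert, Finset.coe_singleton, Set.mem_insert_iff,
      Set.mem_singleton_iff] at hx
    rcases hx with rfl | rfl <;> simp
  let M : Finset G := {1, u} ∪ K ∪ (S ∪ P * K)
  obtain ⟨w, hw⟩ := hG.exists_isFree (words M)
  let X : Finset G := S ∪ P * K
  let Q : Finset G := S ∪ X * {w} * {1, u}
  have hQ : IsSpaced (K : Set G) Q := by
    have h1M : ({1} : Finset G) ⊆ M := by intro x hx; simp [M, Finset.mem_singleton.1 hx]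
    have huM : ({1, u} : Finset G) ⊆ M := Finset.subset_union_left.trans Finset.subset_union_left
    have hXM : X ⊆ M := Finset.subset_union_right
    refine (hw.isSpaced (S := S) (X := X) (Y := {1, u}) (X' := {1}) (Y' := {1})
      (Finset.subset_union_right.trans Finset.subset_union_left)
      (Finset.subset_union_left.trans hXM) hXM huM h1M h1M hS h1u hs).mono ?_
    exact Finset.coe_subset.2 Finset.subset_union_left
  have inQ : ∀ {x}, x ∈ X → x * w ∈ Q ∧ x * w * u ∈ Q := fun {x} hx => by
    have h := Finset.mul_mem_mul hx (Finset.mem_singleton_self w)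
    refine ⟨Finset.mem_union_right _ ?_, Finset.mem_union_right _
      (Finset.mul_mem_mul h (by simp))⟩
    simpa using Finset.mul_mem_mul h (show (1 : G) ∈ ({1, u} : Finset G) by simp)
  have hPKw : ∀ a ∈ P, ∀ k ∈ K, a * k * w ∈ Q := fun a ha k hk =>
    (inQ (Finset.mem_union_right _ (Finset.mul_mem_mul ha hk))).1
  have hPKu : ∀ a ∈ P, ∀ k ∈ K, a * k * u ∈ Q := fun a ha k hk => by
    have h := Finset.mul_mem_mul (Finset.mul_mem_mul (Finset.mul_mem_mul ha hk)
      (Finset.mem_singleton_self u)) (Finset.mem_singleton_self (1 : G))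
    rw [mul_one] at h
    exact Finset.mem_union_left _ (Finset.mem_union_left _ (Finset.mem_union_right _ h))
  have hPKu' : ∀ a ∈ P, ∀ k ∈ K, a * k * u⁻¹ ∈ Q := fun a ha k hk => by
    have h := Finset.mul_mem_mul (Finset.mul_mem_mul (Finset.mul_mem_mul ha hk)
      (Finset.mem_singleton_self u⁻¹)) (Finset.mem_singleton_self (1 : G))
    rw [mul_one] at h
    exact Finset.mem_union_left _ (Finset.mem_union_right _ h)
  refine ⟨P, Q, hPne, hP, hQ, fun a ha k hk b hb => ?_, fun a ha k hk b hb => ?_⟩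
  · obtain ⟨l, hl, h⟩ := hPA a ha k hk b hb
    exact ⟨l, hl, Finset.mem_union_left _ (Finset.mem_union_left _ (Finset.mem_union_left _ h))⟩
  · suffices h : ∃ v, b * v ∈ Q ∧ a * k * v ∈ Q by
      obtain ⟨v, h₁, h₂⟩ := h
      exact ⟨b * v, h₁, by simpa [mul_assoc] using h₂⟩
    -- Right multiplication by `w` sends `S` into `Q`, while `u` and `u⁻¹` exchange `X w` and `X w
    -- u`. So `v` is `w`, `u` or `u⁻¹` according to the layer of `b`, and `Q` contains `P K w`, `P K
    -- u` and `P K u⁻¹`.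
    rcases Finset.mem_union.1 hb with hb | hb
    · exact ⟨w, (inQ (Finset.mem_union_left _ hb)).1, hPKw a ha k hk⟩
    · obtain ⟨z, hz, y, hy, rfl⟩ := Finset.mem_mul.1 hb
      obtain ⟨x, hx, v, hv, rfl⟩ := Finset.mem_mul.1 hz
      rw [Finset.mem_singleton.1 hv]
      rcases Finset.mem_insert.1 hy with rfl | hy
      · exact ⟨u, by simpa using (inQ hx).2, hPKu a ha k hk⟩
      · rw [Finset.mem_singleton.1 hy]
        exact ⟨u⁻¹, by simpa using (inQ hx).1, hPKu' a ha k hk⟩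

end Pieces

end GenericShifts

/-! ### Maximal spaced sets, markings, and their gluing. -/

namespace GenericShifts

section Saturated

open scoped Pointwise

variable {G : Type*} [Group G]

/-- A set is saturated, relative to a set of steps `T` and a forbidden region `Z`, if it is a
`T`-spaced set outside of `Z` that is a step away from each element outside of `Z`. -/
structure IsSaturated (T Z D : Set G) : Prop where
  notMem : ∀ g ∈ D, g ∉ Z
  isSpaced : IsSpaced T D
  exists_mem : ∀ g, g ∉ Z → ∃ d ∈ D, g⁻¹ * d ∈ T

theorem IsSpaced.exists_isSaturated {T Z D : Set G} (h1 : (1 : G) ∈ T)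
    (hinv : ∀ t ∈ T, t⁻¹ ∈ T) (hD : IsSpaced T D) (hDZ : ∀ g ∈ D, g ∉ Z) :
    ∃ D', D ⊆ D' ∧ IsSaturated T Z D' := by
  obtain ⟨D', hDD', hmax⟩ := zorn_subset_nonempty {D | IsSpaced T D ∧ ∀ g ∈ D, g ∉ Z} (by
    intro c hc hchain _
    refine ⟨⋃₀ c, ⟨?_, ?_⟩, fun s hs => Set.subset_sUnion_of_mem hs⟩
    · rintro p ⟨s, hs, hp⟩ p' ⟨s', hs', hp'⟩
      rcases hchain.total hs hs' with h | h
      · exact (hc hs').1 p (h hp) p' hp'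
      · exact (hc hs).1 p hp p' (h hp')
    · rintro g ⟨s, hs, hg⟩
      exact (hc hs).2 g hg) D ⟨hD, hDZ⟩
  refine ⟨D', hDD', hmax.prop.2, hmax.prop.1, fun g hg => ?_⟩
  by_contra! h
  have hgD : g ∉ D' := fun hgD => h g hgD (by simpa using h1)
  refine hgD (hmax.le_of_ge (y := insert g D') ⟨?_, ?_⟩ (Set.subset_insert _ _)
    (Set.mem_insert _ _))
  · rintro p (rfl | hp) p' (rfl | hp') hT
    · rfl
    · exact (h p' hp' hT).elim
    · exact (h p hp (by simpa using hinv _ hT)).elim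
    · exact hmax.prop.1 p hp p' hp' hT
  · rintro p (rfl | hp)
    · exact hg
    · exact hmax.prop.2 p hp

theorem exists_isSaturated {T : Set G} (Z : Set G) (h1 : (1 : G) ∈ T)
    (hinv : ∀ t ∈ T, t⁻¹ ∈ T) : ∃ D, IsSaturated T Z D := by
  obtain ⟨D, -, hD⟩ := IsSpaced.exists_isSaturated (T := T) (Z := Z) (D := ∅) h1 hinv
    (fun p hp => hp.elim) fun p hp => hp.elim
  exact ⟨D, hD⟩

/-- A saturated set `D` with no forbidden region satisfies `D * T = G`, so it is infinite when `T`
is finite. -/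
theorem exists_infinite_isSpaced [Infinite G] {T : Set G} (hT : T.Finite) (h1 : (1 : G) ∈ T)
    (hinv : ∀ t ∈ T, t⁻¹ ∈ T) : ∃ D : Set G, D.Infinite ∧ IsSpaced T D := by
  obtain ⟨D, hD⟩ := exists_isSaturated ∅ h1 hinv
  refine ⟨D, fun hfin => Set.infinite_univ ((hfin.mul hT).subset fun g _ => ?_), hD.isSpaced⟩
  obtain ⟨d, hd, ht⟩ := hD.exists_mem g (Set.notMem_empty g)
  exact ⟨d, hd, _, hinv _ ht, by group⟩

theorem IsSaturated.translate {T Z D : Set G} (hD : IsSaturated T Z D) (a : G) :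
    IsSaturated T {g | a * g ∈ Z} {g | a * g ∈ D} := by
  refine ⟨fun g hg => hD.notMem _ hg, fun g hg g' hg' hT => ?_, fun g hg => ?_⟩
  · exact mul_left_cancel (hD.isSpaced _ hg _ hg' (by simpa [mul_assoc] using hT))
  · obtain ⟨d, hd, hT⟩ := hD.exists_mem _ hg
    exact ⟨a⁻¹ * d, by simpa using hd, by simpa [mul_assoc] using hT⟩

/-- Saturated sets can be glued along regions that are far apart. -/
theorem IsSaturated.exists_glue {T Z Z₁ Z₂ D₁ D₂ N₁ N₂ : Set G} (h1 : (1 : G) ∈ T)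
    (hinv : ∀ t ∈ T, t⁻¹ ∈ T) (hD₁ : IsSaturated T Z₁ D₁) (hD₂ : IsSaturated T Z₂ D₂)
    (hZ₁ : ∀ g ∈ N₁ * T, (g ∈ Z ↔ g ∈ Z₁)) (hZ₂ : ∀ g ∈ N₂ * T, (g ∈ Z ↔ g ∈ Z₂))
    (hfar : ∀ a ∈ N₁ * T, ∀ b ∈ N₂ * T, a⁻¹ * b ∉ T) :
    ∃ D, IsSaturated T Z D ∧ (∀ g ∈ N₁, (g ∈ D ↔ g ∈ D₁)) ∧ ∀ g ∈ N₂, (g ∈ D ↔ g ∈ D₂) := by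
  obtain ⟨D, hsub, hD⟩ := IsSpaced.exists_isSaturated (T := T) (Z := Z)
    (D := D₁ ∩ (N₁ * T) ∪ D₂ ∩ (N₂ * T)) h1 hinv (by
      rintro p (⟨hp, hpN⟩ | ⟨hp, hpN⟩) p' (⟨hp', hpN'⟩ | ⟨hp', hpN'⟩) hT
      · exact hD₁.isSpaced p hp p' hp' hT
      · exact (hfar _ hpN _ hpN' hT).elim
      · exact (hfar _ hpN' _ hpN (by simpa using hinv _ hT)).elim
      · exact hD₂.isSpaced p hp p' hp' hT) (by
      rintro p (⟨hp, hpN⟩ | ⟨hp, hpN⟩)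
      · exact fun h => hD₁.notMem p hp ((hZ₁ p hpN).1 h)
      · exact fun h => hD₂.notMem p hp ((hZ₂ p hpN).1 h))
  -- A point `g` of `D` in `N` is a step away from some `d ∈ D'` by saturation; `d` lies in `N * T`,
  -- hence in `D`, and spacing gives `g = d`.
  have key : ∀ {Z' D' N : Set G}, IsSaturated T Z' D' → (∀ g ∈ N * T, (g ∈ Z ↔ g ∈ Z')) →
      D' ∩ (N * T) ⊆ D → ∀ g ∈ N, (g ∈ D ↔ g ∈ D') := by
    intro Z' D' N hD' hZ' hsub' g hg
    have hgT : g ∈ N * T := ⟨g, hg, 1, h1, mul_one g⟩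
    refine ⟨fun hgD => ?_, fun hgD => hsub' ⟨hgD, hgT⟩⟩
    obtain ⟨d, hd, hT⟩ := hD'.exists_mem g fun h => hD.notMem g hgD ((hZ' g hgT).2 h)
    rwa [hD.isSpaced g hgD d (hsub' ⟨hd, g, hg, _, hT, by group⟩) hT]
  exact ⟨D, hD, key hD₁ hZ₁ (Set.subset_union_left.trans hsub),
    key hD₂ hZ₂ (Set.subset_union_right.trans hsub)⟩

/-- A pair of saturated sets from which the markers `D₁ * P ∪ D₂ * Q` are built; the second set has
priority over the first. -/
structure IsMarking (K P Q D₁ D₂ : Set G) : Prop where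
  left : IsSaturated (P * K * P⁻¹) {g | ∃ d ∈ D₂, g⁻¹ * d ∈ P * K * Q⁻¹} D₁
  right : IsSaturated (Q * K * Q⁻¹) ∅ D₂

theorem mem_mul_mul_inv {K P Q : Set G} {g : G} :
    g ∈ P * K * Q⁻¹ ↔ ∃ a ∈ P, ∃ k ∈ K, ∃ b ∈ Q, g = a * k * b⁻¹ := by
  constructor
  · rintro ⟨_, ⟨a, ha, k, hk, rfl⟩, b, hb, rfl⟩
    exact ⟨a, ha, k, hk, b⁻¹, hb, by simp⟩
  · rintro ⟨a, ha, k, hk, b, hb, rfl⟩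
    exact ⟨_, ⟨a, ha, k, hk, rfl⟩, b⁻¹, by simpa using hb, rfl⟩

theorem inv_mem_mul_mul_inv {K P : Set G} (hK : ∀ k ∈ K, k⁻¹ ∈ K) :
    ∀ g ∈ P * K * P⁻¹, g⁻¹ ∈ P * K * P⁻¹ := by
  intro g hg
  obtain ⟨a, ha, k, hk, b, hb, rfl⟩ := mem_mul_mul_inv.1 hg
  exact mem_mul_mul_inv.2 ⟨b, hb, k⁻¹, hK k hk, a, ha, by group⟩

theorem one_mem_mul_mul_inv {K P : Set G} (hK : (1 : G) ∈ K) (hP : P.Nonempty) :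
    (1 : G) ∈ P * K * P⁻¹ := by
  obtain ⟨a, ha⟩ := hP
  exact mem_mul_mul_inv.2 ⟨a, ha, 1, hK, a, ha, by group⟩

theorem exists_isMarking {K P Q : Set G} (h1 : (1 : G) ∈ K) (hK : ∀ k ∈ K, k⁻¹ ∈ K)
    (hP : P.Nonempty) (hQ : Q.Nonempty) : ∃ D₁ D₂, IsMarking K P Q D₁ D₂ := by
  obtain ⟨D₂, h₂⟩ := exists_isSaturated ∅ (one_mem_mul_mul_inv h1 hQ) (inv_mem_mul_mul_inv hK)
  obtain ⟨D₁, h₁⟩ := exists_isSaturated {g | ∃ d ∈ D₂, g⁻¹ * d ∈ P * K * Q⁻¹}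
    (one_mem_mul_mul_inv h1 hP) (inv_mem_mul_mul_inv hK)
  exact ⟨D₁, D₂, h₁, h₂⟩

namespace IsMarking

variable {K P Q D₁ D₂ D₁' D₂' : Set G}

/-- The step sets and the forbidden region record exactly the displacements at which two of the
translates of `P` and `Q` come `K`-close. -/
theorem isSpaced (h : IsMarking K P Q D₁ D₂) (hK : ∀ k ∈ K, k⁻¹ ∈ K) (hP : IsSpaced K P)
    (hQ : IsSpaced K Q) : IsSpaced K (D₁ * P ∪ D₂ * Q) := by
  rintro _ (⟨d, hd, p, hp, rfl⟩ | ⟨d, hd, p, hp, rfl⟩) _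
    (⟨d', hd', p', hp', rfl⟩ | ⟨d', hd', p', hp', rfl⟩) hk <;> beta_reduce at hk ⊢
  · obtain rfl : d = d' := h.left.isSpaced d hd d' hd'
      (mem_mul_mul_inv.2 ⟨p, hp, _, hk, p', hp', by group⟩)
    rw [hP p hp p' hp' (by simpa [mul_assoc] using hk)]
  · exact (h.left.notMem d hd ⟨d', hd', mem_mul_mul_inv.2 ⟨p, hp, _, hk, p', hp', by group⟩⟩).elim
  · exact (h.left.notMem d' hd' ⟨d, hd, mem_mul_mul_inv.2
      ⟨p', hp', _, hK _ hk, p, hp, by group⟩⟩).elim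
  · obtain rfl : d = d' := h.right.isSpaced d hd d' hd'
      (mem_mul_mul_inv.2 ⟨p, hp, _, hk, p', hp', by group⟩)
    rw [hQ p hp p' hp' (by simpa [mul_assoc] using hk)]

theorem translate (h : IsMarking K P Q D₁ D₂) (a : G) :
    IsMarking K P Q {g | a * g ∈ D₁} {g | a * g ∈ D₂} := by
  refine ⟨?_, h.right.translate a⟩
  convert h.left.translate a using 1
  ext g
  constructor
  · rintro ⟨d, hd, hT⟩
    exact ⟨a * d, hd, by simpa [mul_assoc] using hT⟩
  · rintro ⟨d, hd, hT⟩
    exact ⟨a⁻¹ * d, by simpa using hd, by simpa [mul_assoc] using hT⟩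

/-- Any two markings share a marker. -/
theorem exists_common (h : IsMarking K P Q D₁ D₂) (h' : IsMarking K P Q D₁' D₂')
    (hPP : ∀ a ∈ P, ∀ k ∈ K, ∀ b ∈ P, ∃ l ∈ P, a * k * b⁻¹ * l ∈ Q)
    (hPQ : ∀ a ∈ P, ∀ k ∈ K, ∀ b ∈ Q, ∃ l ∈ Q, a * k * b⁻¹ * l ∈ Q) :
    ∃ g ∈ D₁ * P ∪ D₂ * Q, g ∈ D₁' * P ∪ D₂' * Q := by
  -- Only the second layer of the second marking is used: the position of `d P` is tested against
  -- the first marking, and `d Q` is then hit.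
  obtain ⟨d, hd, -⟩ := h'.right.exists_mem 1 (Set.notMem_empty _)
  by_cases hdZ : ∃ e ∈ D₂, d⁻¹ * e ∈ P * K * Q⁻¹
  · obtain ⟨e, he, hT⟩ := hdZ
    obtain ⟨a, ha, k, hk, b, hb, heq⟩ := mem_mul_mul_inv.1 hT
    obtain ⟨l, hl, hlQ⟩ := hPQ a ha k hk b hb
    rw [← heq] at hlQ
    exact ⟨e * l, Or.inr ⟨e, he, l, hl, rfl⟩, Or.inr ⟨d, hd, _, hlQ, by group⟩⟩
  · obtain ⟨e, he, hT⟩ := h.left.exists_mem d hdZ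
    obtain ⟨a, ha, k, hk, b, hb, heq⟩ := mem_mul_mul_inv.1 hT
    obtain ⟨l, hl, hlQ⟩ := hPP a ha k hk b hb
    rw [← heq] at hlQ
    exact ⟨e * l, Or.inl ⟨e, he, l, hl, rfl⟩, Or.inr ⟨d, hd, _, hlQ, by group⟩⟩

/-- Markings can be glued along regions that are far apart. -/
theorem exists_glue {T N₁ N₂ : Set G} (h : IsMarking K P Q D₁ D₂)
    (h' : IsMarking K P Q D₁' D₂') (h1 : (1 : G) ∈ K) (hK : ∀ k ∈ K, k⁻¹ ∈ K)
    (hP : P.Nonempty) (hQ : Q.Nonempty) (hPPT : P * K * P⁻¹ ⊆ T) (hPQT : P * K * Q⁻¹ ⊆ T)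
    (hQQT : Q * K * Q⁻¹ ⊆ T) (hfar : Disjoint (N₁ * T * T * T * T) (N₂ * T * T * T * T)) :
    ∃ D₁'' D₂'', IsMarking K P Q D₁'' D₂'' ∧
      (∀ g ∈ N₁, (g ∈ D₁'' ↔ g ∈ D₁) ∧ (g ∈ D₂'' ↔ g ∈ D₂)) ∧
      ∀ g ∈ N₂, (g ∈ D₁'' ↔ g ∈ D₁') ∧ (g ∈ D₂'' ↔ g ∈ D₂') := by
  have h1T : (1 : G) ∈ T := hPPT (one_mem_mul_mul_inv h1 hP)
  have hself : ∀ N : Set G, N ⊆ N * T := fun N g hg => ⟨g, hg, 1, h1T, mul_one g⟩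
  -- The four factors `T`: the forbidden region must be right one step around `N`, it depends on
  -- `D₂` one step further, and gluing `D₂` takes a third step for the neighbourhood and a fourth
  -- for the separation.
  have hfar' : ∀ U ⊆ T, ∀ V ⊆ T, ∀ a ∈ N₁ * T * T * U, ∀ b ∈ N₂ * T * T * U, a⁻¹ * b ∉ V := by
    intro U hU V hV a ha b hb hab
    exact Set.disjoint_left.1 hfar
      ⟨a, Set.mul_subset_mul_left hU ha, _, hV hab, by simp⟩
      (hself _ (Set.mul_subset_mul_left hU hb))
  obtain ⟨D₂'', h₂, h₂₁, h₂₂⟩ := h.right.exists_glue (Z := ∅) (N₁ := N₁ * T * T)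
    (N₂ := N₂ * T * T) (one_mem_mul_mul_inv h1 hQ) (inv_mem_mul_mul_inv hK) h'.right
    (fun _ _ => Iff.rfl) (fun _ _ => Iff.rfl) (hfar' _ hQQT _ hQQT)
  have hZ : ∀ {N E : Set G}, (∀ g ∈ N * T * T, (g ∈ D₂'' ↔ g ∈ E)) → ∀ g ∈ N * (P * K * P⁻¹),
      (g ∈ {g | ∃ d ∈ D₂'', g⁻¹ * d ∈ P * K * Q⁻¹} ↔ g ∈ {g | ∃ d ∈ E, g⁻¹ * d ∈ P * K * Q⁻¹}) := by
    intro N E hN g hg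
    refine exists_congr fun d => and_congr_left fun hd => hN d ?_
    exact ⟨g, Set.mul_subset_mul_left hPPT hg, _, hPQT hd, by simp⟩
  obtain ⟨D₁'', h₁, h₁₁, h₁₂⟩ := h.left.exists_glue
    (Z := {g | ∃ d ∈ D₂'', g⁻¹ * d ∈ P * K * Q⁻¹}) (N₁ := N₁) (N₂ := N₂)
    (one_mem_mul_mul_inv h1 hP) (inv_mem_mul_mul_inv hK) h'.left (hZ h₂₁) (hZ h₂₂)
    (fun a ha b hb => hfar' _ hPPT _ hPPT a
      (Set.mul_subset_mul_right ((hself _).trans (hself _)) ha) b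
      (Set.mul_subset_mul_right ((hself _).trans (hself _)) hb))
  refine ⟨D₁'', D₂'', ⟨h₁, h₂⟩, fun g hg => ⟨h₁₁ g hg, h₂₁ g ?_⟩,
    fun g hg => ⟨h₁₂ g hg, h₂₂ g ?_⟩⟩
  · exact hself _ (hself _ hg)
  · exact hself _ (hself _ hg)

end IsMarking

end Saturated

end GenericShifts

/-! ### Gluing infinitely many patterns in a strongly irreducible shift. -/

namespace GenericShifts

section Gluing

open scoped Pointwise

variable {G A : Type*}

theorem isClosed_eqOn [TopologicalSpace A] [DiscreteTopology A] (s : G → A) (E : Set G) :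
    IsClosed {t : G → A | Set.EqOn t s E} := by
  have : {t : G → A | Set.EqOn t s E} = ⋂ g ∈ E, {t | t g = s g} := by
    ext t
    simp [Set.EqOn]
  rw [this]
  exact isClosed_biInter fun g _ => isClosed_eq (continuous_apply g) continuous_const

variable [Group G]

theorem translate_mul_apply (g h : G) (s : G → A) : translate g s (g * h) = s h := by
  simp [translate]

theorem eqOn_translate {F : Set G} {g : G} {s t : G → A} :
    Set.EqOn s (translate g t) ({g} * F) ↔ ∀ f ∈ F, s (g * f) = t f := by
  constructor
  · intro h f hf
    rw [h ⟨g, rfl, f, hf, rfl⟩, translate_mul_apply]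
  · rintro h _ ⟨_, rfl, f, hf, rfl⟩
    rw [translate_mul_apply]
    exact h f hf

variable [TopologicalSpace A]

/-- Configurations of `S` can be glued along any two sets whose `X`-neighbourhoods are disjoint. -/
def Shift.Glues (S : Shift G A) (X : Set G) : Prop :=
  ∀ E₁ E₂ : Set G, Disjoint (E₁ * X) (E₂ * X) →
    ∀ s₁ ∈ S.1, ∀ s₂ ∈ S.1, ∃ s ∈ S.1, Set.EqOn s s₁ E₁ ∧ Set.EqOn s s₂ E₂

/-- Any family of configurations can be glued along sets whose `X`-neighbourhoods are disjoint. -/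
theorem Shift.Glues.exists_eqOn [DiscreteTopology A] {S : Shift G A} {X : Set G} (hS : S.Glues X)
    {ι : Type*} (E : ι → Set G) (s : ι → G → A) (hs : ∀ i, s i ∈ S.1)
    (hE : Pairwise fun i j => Disjoint (E i * X) (E j * X)) :
    ∃ t ∈ S.1, ∀ i, Set.EqOn t (s i) (E i) := by
  classical
  have hfin : ∀ J : Finset ι, ∃ t ∈ S.1, ∀ i ∈ J, Set.EqOn t (s i) (E i) := by
    intro J
    induction J using Finset.induction_on with
    | empty =>
      obtain ⟨t, ht⟩ := S.1.nonempty
      exact ⟨t, ht, by simp⟩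
    | insert i J hi ih =>
      obtain ⟨t, ht, htJ⟩ := ih
      obtain ⟨t', ht', h₁, h₂⟩ := hS (E i) (⋃ j ∈ J, E j) (by
        rw [Set.disjoint_left]
        rintro _ hg ⟨e, he, x, hx, rfl⟩
        obtain ⟨j, hj, he⟩ := Set.mem_iUnion₂.1 he
        exact Set.disjoint_left.1 (hE fun h : i = j => hi (h ▸ hj)) hg ⟨e, he, x, hx, rfl⟩)
        (s i) (hs i) t ht
      refine ⟨t', ht', fun j hj => ?_⟩
      rcases Finset.mem_insert.1 hj with rfl | hj
      · exact h₁
      · exact (h₂.mono (Set.subset_biUnion_of_mem (u := E) hj)).trans (htJ j hj)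
  obtain ⟨t, ht, htE⟩ := S.1.isCompact.inter_iInter_nonempty
    (fun i => {t : G → A | Set.EqOn t (s i) (E i)}) (fun i => isClosed_eqOn _ _) (by
      intro J
      obtain ⟨t, ht, h⟩ := hfin J
      exact ⟨t, ht, Set.mem_iInter₂.2 h⟩)
  exact ⟨t, ht, Set.mem_iInter.1 htE⟩

/-- The steps between the centres of two translates of `F` whose `X`-neighbourhoods meet. -/
def collisions (F X : Set G) : Set G := F * X * (F * X)⁻¹

theorem one_mem_collisions {F X : Set G} (hF : F.Nonempty) (hX : X.Nonempty) :
    (1 : G) ∈ collisions F X := by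
  obtain ⟨a, ha⟩ := hF.mul hX
  exact ⟨a, ha, a⁻¹, Set.inv_mem_inv.2 ha, by simp⟩

theorem inv_mem_collisions {F X : Set G} : ∀ k ∈ collisions F X, k⁻¹ ∈ collisions F X := by
  rintro _ ⟨a, ha, b, hb, rfl⟩
  exact ⟨b⁻¹, hb, a⁻¹, Set.inv_mem_inv.2 ha, by simp⟩

theorem finite_collisions {F X : Set G} (hF : F.Finite) (hX : X.Finite) :
    (collisions F X).Finite :=
  (hF.mul hX).mul (hF.mul hX).inv

theorem IsSpaced.disjoint {F X M : Set G} (hM : IsSpaced (collisions F X) M) {g h : G}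
    (hg : g ∈ M) (hh : h ∈ M) (hne : g ≠ h) : Disjoint ({g} * F * X) ({h} * F * X) := by
  rw [Set.disjoint_left]
  rintro _ ⟨_, ⟨a, ha, f, hf, rfl⟩, x, hx, rfl⟩ ⟨_, ⟨b, hb, f', hf', rfl⟩, x', hx', he⟩
  have he : h * f' * x' = g * f * x := by
    rw [← Set.mem_singleton_iff.1 ha, ← Set.mem_singleton_iff.1 hb]
    exact he
  refine hne (hM g hg h hh ⟨f * x, ⟨f, hf, x, hx, rfl⟩, (f' * x')⁻¹,
    Set.inv_mem_inv.2 (Set.mul_mem_mul hf' hx'), ?_⟩)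
  calc f * x * (f' * x')⁻¹ = g⁻¹ * (g * f * x) * (f' * x')⁻¹ := by group
    _ = g⁻¹ * h := by rw [← he]; group

/-- Some configuration contains all of the `F`-patterns of the shift within a finite window. -/
theorem Shift.Glues.exists_universal [Infinite G] [Finite A] [DiscreteTopology A] {S : Shift G A}
    {X : Set G} (hS : S.Glues X) (hX : X.Finite) (hX' : X.Nonempty) {F : Set G} (hF : F.Finite)
    (hF' : F.Nonempty) : ∃ s ∈ S.1, ∃ N : Set G, N.Finite ∧ ∀ x ∈ S.1, ∃ g ∈ N, ∀ f ∈ F,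
      s (g * f) = x f := by
  -- An infinite spaced set offers a separate site for each of the finitely many `F`-patterns.
  obtain ⟨M, hMinf, hM⟩ := exists_infinite_isSpaced (finite_collisions hF hX)
    (one_mem_collisions hF' hX') inv_mem_collisions
  have : Finite F := hF
  have : Infinite M := hMinf.to_subtype
  let pat : S.Points → F → A := fun x f => x.1 f
  obtain ⟨n, ⟨e⟩⟩ := Finite.exists_equiv_fin (Set.range pat)
  let c : Set.range pat → M := fun p => Infinite.natEmbedding M (e p)
  have hc : Function.Injective c := fun p q h =>
    e.injective (Fin.ext ((Infinite.natEmbedding M).injective h))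
  choose r hr using fun p : Set.range pat => p.2
  obtain ⟨t, ht, htE⟩ := hS.exists_eqOn (fun p => {(c p : G)} * F)
    (fun p => translate (c p : G) (r p).1) (fun p => S.2 _ _ (r p).2) fun p q hpq =>
      hM.disjoint (c p).2 (c q).2 fun h => hpq (hc (Subtype.ext h))
  refine ⟨t, ht, Set.range fun p => (c p : G), Set.finite_range _, fun x hx => ?_⟩
  refine ⟨_, ⟨⟨pat ⟨x, hx⟩, Set.mem_range_self _⟩, rfl⟩, fun f hf => ?_⟩
  rw [eqOn_translate.1 (htE _) f hf]
  exact congrFun (hr ⟨pat ⟨x, hx⟩, Set.mem_range_self _⟩) ⟨f, hf⟩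

end Gluing

end GenericShifts

/-! ### The subshift of configurations with forced patterns at markers. -/

namespace GenericShifts

section Marked

open scoped Pointwise

variable {G A : Type*} [Group G]

/-- The configurations in `S` with copies of the `F`-pattern of `s₀` at the markers of some
marking. -/
def marked (S : Set (G → A)) (K P Q F : Set G) (s₀ : G → A) : Set (G → A) :=
  {s | s ∈ S ∧ ∃ D₁ D₂, IsMarking K P Q D₁ D₂ ∧
    ∀ g ∈ D₁ * P ∪ D₂ * Q, ∀ f ∈ F, s (g * f) = s₀ f}

/-- For finite `K`, `P`, `Q` every clause is a family of conditions on finitely many coordinates: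
the existentials range over finite sets of steps, and "outside of the forbidden region" becomes a
disjunction. This makes markings a closed condition. -/
theorem isMarking_iff {K P Q D₁ D₂ : Set G} : IsMarking K P Q D₁ D₂ ↔
    (∀ g d, g⁻¹ * d ∈ P * K * Q⁻¹ → g ∈ D₁ → d ∈ D₂ → False) ∧
    (∀ g d, g⁻¹ * d ∈ P * K * P⁻¹ → g ≠ d → g ∈ D₁ → d ∈ D₁ → False) ∧
    (∀ g d, g⁻¹ * d ∈ Q * K * Q⁻¹ → g ≠ d → g ∈ D₂ → d ∈ D₂ → False) ∧
    (∀ g, (∃ t ∈ P * K * Q⁻¹, g * t ∈ D₂) ∨ ∃ t ∈ P * K * P⁻¹, g * t ∈ D₁) ∧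
    ∀ g, ∃ t ∈ Q * K * Q⁻¹, g * t ∈ D₂ := by
  have key : ∀ (D T : Set G) (g : G), (∃ d ∈ D, g⁻¹ * d ∈ T) ↔ ∃ t ∈ T, g * t ∈ D := by
    intro D T g
    constructor
    · rintro ⟨d, hd, hT⟩
      exact ⟨_, hT, by simpa using hd⟩
    · rintro ⟨t, ht, hD⟩
      exact ⟨_, hD, by simpa using ht⟩
  constructor
  · intro h
    refine ⟨fun g d hT hg hd => h.left.notMem g hg ⟨d, hd, hT⟩,
      fun g d hT hne hg hd => hne (h.left.isSpaced g hg d hd hT),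
      fun g d hT hne hg hd => hne (h.right.isSpaced g hg d hd hT), fun g => ?_,
      fun g => (key _ _ _).1 (h.right.exists_mem g (Set.notMem_empty g))⟩
    rw [← key D₂, ← key D₁]
    exact or_iff_not_imp_left.2 (h.left.exists_mem g)
  · rintro ⟨h₁, h₂, h₃, h₄, h₅⟩
    refine ⟨⟨?_, ?_, ?_⟩, ⟨?_, ?_, ?_⟩⟩
    · rintro g hg ⟨d, hd, hT⟩
      exact h₁ g d hT hg hd
    · exact fun g hg d hd hT => by_contra fun hne => h₂ g d hT hne hg hd
    · intro g hg
      have := h₄ g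
      rw [← key D₂, ← key D₁] at this
      exact this.resolve_left hg
    · exact fun g _ => Set.notMem_empty g
    · exact fun g hg d hd hT => by_contra fun hne => h₃ g d hT hne hg hd
    · exact fun g _ => (key _ _ _).2 (h₅ g)

/-- The marking is existentially quantified, so the set is the projection of a closed subset of `S ×
{0,1}^G × {0,1}^G`. -/
theorem isCompact_marked [TopologicalSpace A] [DiscreteTopology A] {S : Set (G → A)}
    (hS : IsCompact S) {K P Q : Set G} (hK : K.Finite) (hP : P.Finite) (hQ : Q.Finite)
    (F : Set G) (s₀ : G → A) : IsCompact (marked S K P Q F s₀) := by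
  let C : Set ((G → A) × (G → Bool) × (G → Bool)) :=
    {p | IsMarking K P Q {g | p.2.1 g = true} {g | p.2.2 g = true} ∧
      ∀ g ∈ {g | p.2.1 g = true} * P ∪ {g | p.2.2 g = true} * Q, ∀ f ∈ F, p.1 (g * f) = s₀ f}
  have h₁ : ∀ g, IsClopen {p : (G → A) × (G → Bool) × (G → Bool) | p.2.1 g = true} := fun g =>
    (isClopen_discrete {true}).preimage (f := fun p : (G → A) × (G → Bool) × (G → Bool) => p.2.1 g)
      (by fun_prop)
  have h₂ : ∀ g, IsClopen {p : (G → A) × (G → Bool) × (G → Bool) | p.2.2 g = true} := fun g =>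
    (isClopen_discrete {true}).preimage (f := fun p : (G → A) × (G → Bool) × (G → Bool) => p.2.2 g)
      (by fun_prop)
  have h₃ : ∀ g a, IsClosed {p : (G → A) × (G → Bool) × (G → Bool) | p.1 g = a} := fun g a =>
    ((isClopen_discrete {a}).preimage (f := fun p : (G → A) × (G → Bool) × (G → Bool) => p.1 g)
      (by fun_prop)).isClosed
  have hex : ∀ (T : Set G) (q : G → Set ((G → A) × (G → Bool) × (G → Bool))), T.Finite →
      (∀ t, IsClopen (q t)) → IsClosed {p | ∃ t ∈ T, p ∈ q t} := by
    intro T q hT hq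
    convert hT.isClosed_biUnion fun t _ => (hq t).isClosed using 1
    ext p
    simp
  have himp : ∀ {q r : (G → A) × (G → Bool) × (G → Bool) → Prop}, IsClopen {p | q p} →
      IsClosed {p | r p} → IsClosed {p | q p → r p} := fun hq hr => isClosed_imp hq.isOpen hr
  have hall : ∀ {ι : Type _} {q : ι → (G → A) × (G → Bool) × (G → Bool) → Prop},
      (∀ i, IsClosed {p | q i p}) → IsClosed {p | ∀ i, q i p} := fun h => by
    simp only [Set.ofPred_forall]
    exact isClosed_iInter h
  have hcond : ∀ {c : Prop} {q : (G → A) × (G → Bool) × (G → Bool) → Prop},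
      IsClosed {p | q p} → IsClosed {p | c → q p} := fun {c q} h => by
    by_cases hc : c <;> simp [hc, h]
  have hfalse : IsClosed {p : (G → A) × (G → Bool) × (G → Bool) | False} := by
    simp
  have hC : IsClosed C := by
    have : C = {p | ((∀ g d, g⁻¹ * d ∈ P * K * Q⁻¹ → p.2.1 g = true → p.2.2 d = true → False) ∧
        (∀ g d, g⁻¹ * d ∈ P * K * P⁻¹ → g ≠ d → p.2.1 g = true → p.2.1 d = true → False) ∧
        (∀ g d, g⁻¹ * d ∈ Q * K * Q⁻¹ → g ≠ d → p.2.2 g = true → p.2.2 d = true → False) ∧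
        (∀ g, (∃ t ∈ P * K * Q⁻¹, p.2.2 (g * t) = true) ∨
          ∃ t ∈ P * K * P⁻¹, p.2.1 (g * t) = true) ∧
        ∀ g, ∃ t ∈ Q * K * Q⁻¹, p.2.2 (g * t) = true) ∧
        (∀ d a f, a ∈ P → f ∈ F → p.2.1 d = true → p.1 (d * a * f) = s₀ f) ∧
        ∀ d a f, a ∈ Q → f ∈ F → p.2.2 d = true → p.1 (d * a * f) = s₀ f} := by
      ext p
      refine and_congr isMarking_iff ⟨fun h => ⟨?_, ?_⟩, ?_⟩
      · exact fun d a f ha hf hd => h _ (Or.inl ⟨d, hd, a, ha, rfl⟩) f hf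
      · exact fun d a f ha hf hd => h _ (Or.inr ⟨d, hd, a, ha, rfl⟩) f hf
      · rintro ⟨hl, hr⟩ _ (⟨d, hd, a, ha, rfl⟩ | ⟨d, hd, a, ha, rfl⟩) f hf
        · exact hl d a f ha hf hd
        · exact hr d a f ha hf hd
    have hTf : ∀ {U V : Set G}, U.Finite → V.Finite → (U * K * V⁻¹).Finite := fun hU hV =>
      (hU.mul hK).mul hV.inv
    rw [this]
    refine IsClosed.and (IsClosed.and ?_ (IsClosed.and ?_ (IsClosed.and ?_ (IsClosed.and ?_ ?_))))
      (IsClosed.and ?_ ?_)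
    · exact hall fun g => hall fun d => hcond <| himp (h₁ g) (himp (h₂ d) hfalse)
    · exact hall fun g => hall fun d => hcond <| hcond <|
        himp (h₁ g) (himp (h₁ d) hfalse)
    · exact hall fun g => hall fun d => hcond <| hcond <|
        himp (h₂ g) (himp (h₂ d) hfalse)
    · exact hall fun g => (hex _ _ (hTf hP hQ) fun t => h₂ (g * t)).union
        (hex _ _ (hTf hP hP) fun t => h₁ (g * t))
    · exact hall fun g => hex _ _ (hTf hQ hQ) fun t => h₂ (g * t)
    · exact hall fun d => hall fun a => hall fun f => hcond <| hcond <|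
        himp (h₁ d) (h₃ _ _)
    · exact hall fun d => hall fun a => hall fun f => hcond <| hcond <|
        himp (h₂ d) (h₃ _ _)
  have himage : marked S K P Q F s₀ = Prod.fst '' ((S ×ˢ Set.univ) ∩ C) := by
    classical
    ext s
    constructor
    · rintro ⟨hs, D₁, D₂, hD, hM⟩
      refine ⟨(s, fun g => decide (g ∈ D₁), fun g => decide (g ∈ D₂)), ⟨⟨hs, trivial⟩, ?_⟩, rfl⟩
      simp only [C, Set.mem_ofPred_eq, decide_eq_true_eq, Set.ofPred_mem_eq]
      exact ⟨hD, hM⟩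
    · rintro ⟨⟨s, D⟩, ⟨⟨hs, -⟩, hD, hM⟩, rfl⟩
      exact ⟨hs, _, _, hD, hM⟩
  rw [himage]
  exact ((hS.prod isCompact_univ).inter_right hC).image continuous_fst

theorem translate_mem_marked {S : Set (G → A)} (hS : ∀ g : G, ∀ s ∈ S, translate g s ∈ S)
    {K P Q F : Set G} {s₀ s : G → A} (g : G) (hs : s ∈ marked S K P Q F s₀) :
    translate g s ∈ marked S K P Q F s₀ := by
  obtain ⟨hsS, D₁, D₂, hD, hM⟩ := hs
  refine ⟨hS g s hsS, _, _, hD.translate g⁻¹, ?_⟩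
  intro h hh f hf
  have : g⁻¹ * h ∈ D₁ * P ∪ D₂ * Q := by
    rcases hh with ⟨d, hd, a, ha, rfl⟩ | ⟨d, hd, a, ha, rfl⟩
    · exact Or.inl ⟨_, hd, a, ha, by simp [mul_assoc]⟩
    · exact Or.inr ⟨_, hd, a, ha, by simp [mul_assoc]⟩
  rw [← hM _ this f hf, translate, mul_assoc]

theorem exists_common_of_mem_marked {S : Set (G → A)} {K P Q F : Set G} {s₀ x y : G → A}
    (hPP : ∀ a ∈ P, ∀ k ∈ K, ∀ b ∈ P, ∃ l ∈ P, a * k * b⁻¹ * l ∈ Q)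
    (hPQ : ∀ a ∈ P, ∀ k ∈ K, ∀ b ∈ Q, ∃ l ∈ Q, a * k * b⁻¹ * l ∈ Q)
    (hx : x ∈ marked S K P Q F s₀) (hy : y ∈ marked S K P Q F s₀) :
    ∃ g, ∀ f ∈ F, x (g * f) = s₀ f ∧ y (g * f) = s₀ f := by
  obtain ⟨-, D₁, D₂, hD, hM⟩ := hx
  obtain ⟨-, D₁', D₂', hD', hM'⟩ := hy
  obtain ⟨g, hg, hg'⟩ := hD.exists_common hD' hPP hPQ
  exact ⟨g, fun f hf => ⟨hM g hg f hf, hM' g hg' f hf⟩⟩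

variable [TopologicalSpace A]

theorem marked_nonempty [DiscreteTopology A] {S : Shift G A} {X : Set G} (hS : S.Glues X)
    {P Q F : Set G} {s₀ : G → A} (hs₀ : s₀ ∈ S.1)
    (h1 : (1 : G) ∈ collisions F X) (hP : P.Nonempty) (hQ : Q.Nonempty)
    (hPs : IsSpaced (collisions F X) P) (hQs : IsSpaced (collisions F X) Q) :
    (marked (S.1 : Set (G → A)) (collisions F X) P Q F s₀).Nonempty := by
  obtain ⟨D₁, D₂, hD⟩ := exists_isMarking h1 inv_mem_collisions hP hQ
  have hsp := hD.isSpaced inv_mem_collisions hPs hQs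
  obtain ⟨t, ht, h⟩ := hS.exists_eqOn
    (fun g : (D₁ * P ∪ D₂ * Q : Set G) => {(g : G)} * F)
    (fun g => translate (g : G) s₀) (fun g => S.2 _ _ hs₀)
    fun g h hgh => hsp.disjoint g.2 h.2 fun he => hgh (Subtype.ext he)
  exact ⟨t, ht, D₁, D₂, hD, fun g hg => eqOn_translate.1 (h ⟨g, hg⟩)⟩

/-- The markers of a marking that belong to `N` depend only on the marking near `N`. -/
theorem mem_markers_congr {P Q N D₁ D₂ D₁' D₂' : Set G}
    (h : ∀ g ∈ N * (P⁻¹ ∪ Q⁻¹), (g ∈ D₁' ↔ g ∈ D₁) ∧ (g ∈ D₂' ↔ g ∈ D₂)) {g : G} (hg : g ∈ N)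
    (hM : g ∈ D₁' * P ∪ D₂' * Q) : g ∈ D₁ * P ∪ D₂ * Q := by
  rcases hM with ⟨d, hd, a, ha, rfl⟩ | ⟨d, hd, a, ha, rfl⟩
  · exact Or.inl ⟨d, (h d ⟨_, hg, a⁻¹, Or.inl (Set.inv_mem_inv.2 ha), by simp⟩).1.1 hd, a, ha, rfl⟩
  · exact Or.inr ⟨d, (h d ⟨_, hg, a⁻¹, Or.inr (Set.inv_mem_inv.2 ha), by simp⟩).2.1 hd, a, ha, rfl⟩

/-- After gluing the markings, `x` and `y` are glued on `E₁`, `E₂` together with the blocks at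
markers near them, where the new marking agrees with the old ones. Copies of `s₀` are then inserted
at all remaining markers. A marker outside of `Eᵢ * B` has a block that does not interfere with
`Eᵢ`, which is the reason for `B = X * X⁻¹ * F⁻¹`. -/
theorem marked_glue [DiscreteTopology A] {S : Shift G A} {X : Set G} (hS : S.Glues X)
    {P Q F : Set G} {s₀ : G → A} (hs₀ : s₀ ∈ S.1)
    (h1 : (1 : G) ∈ collisions F X) (hP : P.Nonempty) (hQ : Q.Nonempty)
    (hPs : IsSpaced (collisions F X) P) (hQs : IsSpaced (collisions F X) Q)
    {B T E₁ E₂ : Set G} (hB : B = X * X⁻¹ * F⁻¹)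
    (hT : T = P * collisions F X * P⁻¹ ∪ P * collisions F X * Q⁻¹ ∪ Q * collisions F X * Q⁻¹)
    (hfar : Disjoint (E₁ * B * (P⁻¹ ∪ Q⁻¹) * T * T * T * T) (E₂ * B * (P⁻¹ ∪ Q⁻¹) * T * T * T * T))
    (hfar' : Disjoint ((E₁ ∪ E₁ * B * F) * X) ((E₂ ∪ E₂ * B * F) * X))
    {x y : G → A} (hx : x ∈ marked (S.1 : Set (G → A)) (collisions F X) P Q F s₀)
    (hy : y ∈ marked (S.1 : Set (G → A)) (collisions F X) P Q F s₀) :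
    ∃ s ∈ marked (S.1 : Set (G → A)) (collisions F X) P Q F s₀,
      Set.EqOn s x E₁ ∧ Set.EqOn s y E₂ := by
  obtain ⟨hxS, D₁, D₂, hD, hDx⟩ := hx
  obtain ⟨hyS, D₁', D₂', hD', hDy⟩ := hy
  obtain ⟨D₁'', D₂'', hM, hMx, hMy⟩ := hD.exists_glue hD' h1 inv_mem_collisions hP hQ
    (hT ▸ Set.subset_union_left.trans Set.subset_union_left)
    (hT ▸ Set.subset_union_right.trans Set.subset_union_left)
    (hT ▸ Set.subset_union_right) hfar
  have hsp := hM.isSpaced inv_mem_collisions hPs hQs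
  set M : Set G := D₁'' * P ∪ D₂'' * Q with hMdef
  have hnear : ∀ E : Set G, E ∪ (M ∩ (E * B)) * F ⊆ E ∪ E * B * F := fun E =>
    Set.union_subset_union_right _ (Set.mul_subset_mul_right Set.inter_subset_right)
  obtain ⟨t, ht, htx, hty⟩ := hS (E₁ ∪ (M ∩ (E₁ * B)) * F) (E₂ ∪ (M ∩ (E₂ * B)) * F)
    (hfar'.mono (Set.mul_subset_mul_right (hnear _)) (Set.mul_subset_mul_right (hnear _)))
    x hxS y hyS
  have hdisj : ∀ (E : Set G) (g : G), g ∈ M → g ∉ E * B →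
      Disjoint ((E ∪ (M ∩ (E * B)) * F) * X) ({g} * F * X) := by
    intro E g hg hgE
    rw [Set.union_mul, Set.disjoint_union_left]
    constructor
    · rw [Set.disjoint_left]
      rintro _ ⟨e, he, a, ha, rfl⟩ ⟨_, ⟨b, hb, f, hf, rfl⟩, a', ha', heq⟩
      rw [Set.mem_singleton_iff] at hb
      subst hb
      have heq : b * f * a' = e * a := heq
      refine hgE ⟨e, he, a * a'⁻¹ * f⁻¹, hB ▸ Set.mul_mem_mul (Set.mul_mem_mul ha
        (Set.inv_mem_inv.2 ha')) (Set.inv_mem_inv.2 hf), ?_⟩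
      calc e * (a * a'⁻¹ * f⁻¹) = e * a * a'⁻¹ * f⁻¹ := by group
        _ = b := by rw [← heq]; group
    · rw [Set.disjoint_left]
      rintro _ ⟨_, ⟨h, hh, f, hf, rfl⟩, a, ha, rfl⟩
      refine Set.disjoint_left.1 (hsp.disjoint hh.1 hg ?_) ⟨_, ⟨h, rfl, f, hf, rfl⟩, a, ha, rfl⟩
      rintro rfl
      exact hgE hh.2
  obtain ⟨s, hs, hsE⟩ := hS.exists_eqOn
    (ι := Option {g // g ∈ M ∧ g ∉ E₁ * B ∧ g ∉ E₂ * B})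
    (fun i => i.elim ((E₁ ∪ (M ∩ (E₁ * B)) * F) ∪ (E₂ ∪ (M ∩ (E₂ * B)) * F))
      fun g => {g.1} * F)
    (fun i => i.elim t fun g => translate g.1 s₀)
    (by rintro (_ | g)
        · exact ht
        · exact S.2 _ _ hs₀)
    (by
      have hd : ∀ g ∈ M, g ∉ E₁ * B → g ∉ E₂ * B →
          Disjoint (((E₁ ∪ (M ∩ (E₁ * B)) * F) ∪ (E₂ ∪ (M ∩ (E₂ * B)) * F)) * X)
            ({g} * F * X) := fun g hg hg₁ hg₂ => by
        rw [Set.union_mul, Set.disjoint_union_left]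
        exact ⟨hdisj _ g hg hg₁, hdisj _ g hg hg₂⟩
      rintro (_ | g) (_ | h) hgh
      · exact (hgh rfl).elim
      · exact hd h.1 h.2.1 h.2.2.1 h.2.2.2
      · exact (hd g.1 g.2.1 g.2.2.1 g.2.2.2).symm
      · exact hsp.disjoint g.2.1 h.2.1 fun he => hgh (congrArg some (Subtype.ext he)))
  have hst : Set.EqOn s t _ := hsE none
  have hsx := (hst.mono Set.subset_union_left).trans htx
  have hsy := (hst.mono Set.subset_union_right).trans hty
  refine ⟨s, ⟨hs, D₁'', D₂'', hM, fun g hg f hf => ?_⟩, hsx.mono Set.subset_union_left,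
    hsy.mono Set.subset_union_left⟩
  by_cases hg₁ : g ∈ E₁ * B
  · rw [hsx (Or.inr ⟨g, ⟨hg, hg₁⟩, f, hf, rfl⟩)]
    exact hDx g (mem_markers_congr hMx hg₁ hg) f hf
  by_cases hg₂ : g ∈ E₂ * B
  · rw [hsy (Or.inr ⟨g, ⟨hg, hg₂⟩, f, hf, rfl⟩)]
    exact hDy g (mem_markers_congr hMy hg₂ hg) f hf
  exact eqOn_translate.1 (hsE (some ⟨g, hg, hg₁, hg₂⟩)) f hf

/-- A strongly irreducible shift over an ICC group contains a strongly irreducible shift any two of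
whose configurations contain all of the `F`-patterns of the original shift at a common place. -/
theorem Shift.IsStronglyIrreducible.exists_subshift [Nontrivial G] (hG : IsICC G) [Finite A]
    [DiscreteTopology A] {S : Shift G A} (hS : S.IsStronglyIrreducible) {F : Set G}
    (hF : F.Finite) (hF' : F.Nonempty) :
    ∃ S' : Shift G A, S'.IsStronglyIrreducible ∧ S'.1 ≤ S.1 ∧
      ∀ x ∈ S'.1, ∀ y ∈ S'.1, ∀ z ∈ S.1, ∃ g, ∀ f ∈ F, x (g * f) = z f ∧ y (g * f) = z f := by
  classical
  have := hG.infinite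
  obtain ⟨X, h1X, hX⟩ := hS
  have hX : S.Glues (X : Set G) := hX
  have hXne : (X : Set G).Nonempty := ⟨1, h1X⟩
  obtain ⟨s₀, hs₀, N, hN, huniv⟩ := hX.exists_universal X.finite_toSet hXne hF hF'
  have hNne : N.Nonempty := ⟨_, (huniv s₀ hs₀).choose_spec.1⟩
  -- Forcing `s₀` on `W` forces every `F`-pattern of `S` at a fixed offset from each marker.
  set W : Set G := N * F with hW
  have hWf : W.Finite := hN.mul hF
  have hWne : W.Nonempty := hNne.mul hF'
  have hKf := finite_collisions hWf X.finite_toSet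
  have h1K := one_mem_collisions hWne hXne
  obtain ⟨P, Q, hPne, hPs, hQs, hPP, hPQ⟩ := hG.exists_spaced_pair hKf.toFinset
    (by simpa using h1K) (fun k hk => by simpa using inv_mem_collisions k (by simpa using hk))
  simp only [Set.Finite.coe_toFinset, Set.Finite.mem_toFinset] at hPs hQs hPP hPQ
  have hQne : Q.Nonempty := by
    obtain ⟨a, ha⟩ := hPne
    obtain ⟨l, -, hl⟩ := hPP a ha 1 h1K a ha
    exact ⟨_, hl⟩
  let C : NonemptyCompacts (G → A) :=
    ⟨⟨marked (S.1 : Set (G → A)) (collisions W X) P Q W s₀,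
      isCompact_marked S.1.isCompact hKf P.finite_toSet Q.finite_toSet W s₀⟩,
      marked_nonempty hX hs₀ h1K hPne hQne hPs hQs⟩
  refine ⟨⟨C, fun g s hs => translate_mem_marked S.2 g hs⟩, ?_, fun s hs => hs.1, ?_⟩
  · set B : Set G := X * (X : Set G)⁻¹ * W⁻¹ with hB
    set T : Set G := P * collisions W X * (P : Set G)⁻¹ ∪ P * collisions W X * (Q : Set G)⁻¹ ∪
      Q * collisions W X * (Q : Set G)⁻¹ with hT
    have hBf : B.Finite := (X.finite_toSet.mul X.finite_toSet.inv).mul hWf.inv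
    have hTf : T.Finite := by
      refine (Set.Finite.union ?_ ?_).union ?_ <;>
        exact ((Finset.finite_toSet _).mul hKf).mul (Finset.finite_toSet _).inv
    have hYf : (insert 1 (B * ((P : Set G)⁻¹ ∪ (Q : Set G)⁻¹) * T * T * T * T ∪
        insert 1 (B * W) * X)).Finite := by
      refine (Set.Finite.union ?_ ?_).insert 1
      · exact ((((hBf.mul (P.finite_toSet.inv.union Q.finite_toSet.inv)).mul hTf).mul hTf).mul
          hTf).mul hTf
      · exact ((hBf.mul hWf).insert 1).mul X.finite_toSet
    refine ⟨hYf.toFinset, by simp, fun E₁ E₂ hE x hx y hy => ?_⟩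
    rw [Set.Finite.coe_toFinset] at hE
    refine marked_glue hX hs₀ h1K hPne hQne hPs hQs hB hT ?_ ?_ hx hy
    · refine hE.mono ?_ ?_ <;>
      · simp only [mul_assoc]
        exact Set.mul_subset_mul_left (Set.subset_union_left.trans (Set.subset_insert _ _))
    · have : ∀ E B W X : Set G, (E ∪ E * B * W) * X = E * (insert 1 (B * W) * X) :=
        fun E B W X => by
          rw [← mul_assoc E (insert 1 (B * W)) X, Set.insert_eq, Set.mul_union, ← mul_assoc E B W,
            Set.singleton_one, mul_one]
      rw [this, this]
      exact hE.mono
        (Set.mul_subset_mul_left (Set.subset_union_right.trans (Set.subset_insert _ _)))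
        (Set.mul_subset_mul_left (Set.subset_union_right.trans (Set.subset_insert _ _)))
  · intro x hx y hy z hz
    obtain ⟨g, hg⟩ := exists_common_of_mem_marked hPP hPQ hx hy
    obtain ⟨n, hn, hz⟩ := huniv z hz
    refine ⟨g * n, fun f hf => ?_⟩
    rw [← hz f hf, mul_assoc]
    exact hg _ (Set.mul_mem_mul hn hf)

end Marked

end GenericShifts

/-! ### Topology of the space of shifts. -/

namespace GenericShifts

section Space

variable {G A : Type*}

theorem exists_finite_cylinder_subset [TopologicalSpace A] {U : Set (G → A)} (hU : IsOpen U)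
    {x : G → A} (hx : x ∈ U) : ∃ F : Set G, F.Finite ∧ ∀ y, (∀ f ∈ F, y f = x f) → y ∈ U := by
  obtain ⟨I, u, hI, hu⟩ := isOpen_pi_iff.1 hU x hx
  refine ⟨I, I.finite_toSet, fun y hy => hu fun f hf => ?_⟩
  rw [hy f hf]
  exact (hI f hf).2

theorem isOpen_cylinder [TopologicalSpace A] [DiscreteTopology A] {F : Set G} (hF : F.Finite)
    (x : G → A) : IsOpen {y : G → A | ∀ f ∈ F, y f = x f} := by
  have : {y : G → A | ∀ f ∈ F, y f = x f} = F.pi fun f => {x f} := by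
    ext y
    simp [Set.mem_pi]
  rw [this]
  exact isOpen_set_pi hF fun f _ => isOpen_discrete _

variable [Group G]

theorem translate_inv_apply (g h : G) (s : G → A) : translate g⁻¹ s h = s (g * h) := by
  simp [translate]

theorem translate_translate (g h : G) (s : G → A) :
    translate g (translate h s) = translate (g * h) s := by
  funext k
  simp [translate, mul_assoc]

theorem translate_one (s : G → A) : translate (1 : G) s = s := by
  funext k
  simp [translate]

variable [TopologicalSpace A]

theorem continuous_translate (g : G) : Continuous (translate g : (G → A) → G → A) :=
  continuous_pi fun h => continuous_apply (g⁻¹ * h)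

/-- Over a group, invariance by inclusion is the same as equality of `K` with its images, an
equation between continuous maps. -/
theorem isClosed_invariant [T2Space A] :
    IsClosed {K : NonemptyCompacts (G → A) | ∀ g : G, ∀ s ∈ K, translate g s ∈ K} := by
  have : {K : NonemptyCompacts (G → A) | ∀ g : G, ∀ s ∈ K, translate g s ∈ K} =
      ⋂ g : G, {K | K.map (translate g) (continuous_translate g) = K} := by
    ext K
    rw [Set.mem_iInter]
    constructor
    · intro h g
      refine NonemptyCompacts.ext ?_
      rw [NonemptyCompacts.coe_map]
      refine Set.Subset.antisymm (Set.image_subset_iff.2 fun s hs => h g s hs) fun s hs => ?_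
      exact ⟨translate g⁻¹ s, h _ s hs, by simp [translate_translate, translate_one]⟩
    · intro h g s hs
      have hg : K.map (translate g) (continuous_translate g) = K := h g
      have : translate g s ∈ (K.map (translate g) (continuous_translate g) : Set (G → A)) := by
        rw [NonemptyCompacts.coe_map]
        exact Set.mem_image_of_mem _ hs
      rwa [hg] at this
  rw [this]
  exact isClosed_iInter fun g =>
    isClosed_eq (continuous_translate g).nonemptyCompacts_map continuous_id

instance [Finite A] [T2Space A] : CompactSpace (Shift G A) :=
  isCompact_iff_compactSpace.1 isClosed_invariant.isCompact

theorem isClosed_isTrivial [T2Space A] : IsClosed {S : Shift G A | S.IsTrivial} := by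
  have : {S : Shift G A | S.IsTrivial} =
      Subtype.val ⁻¹' Set.range ({·} : (G → A) → NonemptyCompacts (G → A)) := by
    ext S
    refine exists_congr fun s => ?_
    constructor
    · exact fun h => NonemptyCompacts.ext (by rw [h, NonemptyCompacts.coe_singleton])
    · intro h
      rw [← show {s} = S.1 from h, NonemptyCompacts.coe_singleton]
  rw [this]
  exact NonemptyCompacts.isClosedEmbedding_singleton.isClosed_range.preimage continuous_subtype_val

/-- A closed set minus a closed set in a compact Hausdorff space is locally compact. -/
instance [Finite A] [T2Space A] : BaireSpace (genericSpace G A) := by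
  have h : IsLocallyClosed (genericSpace G A) :=
    isClosed_closure.isLocallyClosed.inter isClosed_isTrivial.isOpen_compl.isLocallyClosed
  have := h.locallyCompactSpace
  infer_instance

/-- Each neighbourhood of a shift `S` contains the shifts in `S` with the same `F`-patterns, for a
suitable finite set `F`. -/
theorem exists_finite_patterns {O : Set (Shift G A)} (hO : IsOpen O) {S : Shift G A}
    (hS : S ∈ O) : ∃ F : Set G, F.Finite ∧ ∀ S' : Shift G A, S'.1 ≤ S.1 →
      (∀ z ∈ S.1, ∃ y ∈ S'.1, ∀ f ∈ F, y f = z f) → S' ∈ O := by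
  obtain ⟨O', hO', rfl⟩ := isOpen_induced_iff.1 hO
  obtain ⟨_, ⟨u, ⟨hu, -, huO⟩, rfl⟩, ⟨hSu, hSU⟩, hsub⟩ :=
    NonemptyCompacts.isTopologicalBasis.exists_subset_of_mem_open hS hO'
  have : Nonempty (G → A) := ⟨S.1.nonempty.some⟩
  choose! z hzS hzU using hSU
  choose! F hF hFU using fun U hU => exists_finite_cylinder_subset (huO U hU) (hzU U hU)
  refine ⟨⋃ U ∈ u, F U, hu.biUnion hF, fun S' hS' h => hsub ⟨?_, fun U hU => ?_⟩⟩
  · exact Set.Subset.trans hS' hSu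
  · obtain ⟨y, hy, hyz⟩ := h (z U) (hzS U hU)
    exact ⟨y, hy, hFU U hU y fun f hf => hyz f (Set.mem_biUnion hU hf)⟩

theorem isOpen_exists_translate_ne [T2Space A] (g : G) :
    IsOpen {S : Shift G A | ∃ x ∈ S.1, translate g x ≠ x} :=
  (NonemptyCompacts.isOpen_inter_nonempty_of_isOpen (U := {x : G → A | translate g x ≠ x})
    (isOpen_ne_fun (continuous_translate g) continuous_id)).preimage continuous_subtype_val

/-- Any two configurations of the shift have an `F`-pattern at a common place, and any one of them
contains all of the `F`-patterns of the other. -/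
def Shift.IsSynchronizing (S : Shift G A) (F : Set G) : Prop :=
  ∀ x ∈ S.1, ∀ y ∈ S.1, (∃ g, ∀ f ∈ F, x (g * f) = y f) ∧ ∃ g, ∀ f ∈ F, x (g * f) = y (g * f)

/-- The condition says that the compact set `S × S`, which depends continuously on `S`, lies in an
open set. -/
theorem isOpen_isSynchronizing [DiscreteTopology A] {F : Set G} (hF : F.Finite) :
    IsOpen {S : Shift G A | S.IsSynchronizing F} := by
  have hpat : ∀ (p q : G → G), IsOpen {z : (G → A) × (G → A) | ∀ f ∈ F, z.1 (p f) = z.2 (q f)} := by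
    intro p q
    have : {z : (G → A) × (G → A) | ∀ f ∈ F, z.1 (p f) = z.2 (q f)} =
        ⋂ f ∈ F, {z | z.1 (p f) = z.2 (q f)} := by
      ext z
      simp
    rw [this]
    refine hF.isOpen_biInter fun f _ => ?_
    exact (isOpen_discrete {a : A × A | a.1 = a.2}).preimage
      (f := fun z : (G → A) × (G → A) => (z.1 (p f), z.2 (q f))) (by fun_prop)
  let V : Set ((G → A) × (G → A)) := (⋃ g, {z | ∀ f ∈ F, z.1 (g * f) = z.2 f}) ∩
    ⋃ g, {z | ∀ f ∈ F, z.1 (g * f) = z.2 (g * f)}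
  have hV : IsOpen V :=
    (isOpen_iUnion fun g => hpat (g * ·) id).inter (isOpen_iUnion fun g => hpat (g * ·) (g * ·))
  have : {S : Shift G A | S.IsSynchronizing F} =
      (fun S : Shift G A => S.1 ×ˢ S.1) ⁻¹' {K | (K : Set ((G → A) × (G → A))) ⊆ V} := by
    ext S
    simp only [Set.mem_preimage, Set.mem_ofPred_eq, NonemptyCompacts.coe_prod, Set.prod_subset_iff,
      V, Set.mem_inter_iff, Set.mem_iUnion]
    rfl
  rw [this]
  exact (NonemptyCompacts.isOpen_subsets_of_isOpen hV).preimage (by fun_prop)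

end Space

end GenericShifts

/-! ### Faithfulness, minimality and proximality through finite patterns; density. -/

namespace GenericShifts

section Dynamics

open scoped Pointwise

variable {G A : Type*} [Group G] [TopologicalSpace A]

/-- Non-trivial strongly irreducible shifts over an ICC group are faithful. -/
theorem Shift.IsStronglyIrreducible.exists_translate_ne {S : Shift G A} (hG : IsICC G)
    (hS : S.IsStronglyIrreducible) (hS' : ¬ S.IsTrivial) {g : G} (hg : g ≠ 1) :
    ∃ x ∈ S.1, translate g x ≠ x := by
  classical
  by_contra! hfix
  obtain ⟨X, -, hX⟩ := hS
  -- A conjugate of `g` outside of `X X⁻¹` also acts trivially, yet its coordinate is independent of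
  -- the one at `1`.
  obtain ⟨c, hc, hcX⟩ := (hG g hg).exists_notMem_finset (X * X⁻¹)
  obtain ⟨h, rfl⟩ := isConj_iff.1 (show IsConj g c from hc)
  have hfix' : ∀ x ∈ S.1, translate (h * g * h⁻¹) x = x := by
    intro x hx
    have := congrArg (translate h) (hfix _ (S.2 h⁻¹ x hx))
    simpa [translate_translate, translate_one, mul_assoc] using this
  refine hS' ?_
  obtain ⟨s, hs⟩ := S.1.nonempty
  refine ⟨s, Set.eq_singleton_iff_unique_mem.2 ⟨hs, fun y hy => funext fun k => ?_⟩⟩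
  obtain ⟨t, ht, h₁, h₂⟩ := hX {1} {h * g * h⁻¹} (by
    rw [Set.disjoint_left]
    rintro _ ⟨a, ha, x, hx, rfl⟩ ⟨b, hb, x', hx', heq⟩
    obtain rfl := Set.mem_singleton_iff.1 ha
    obtain rfl := Set.mem_singleton_iff.1 hb
    refine hcX ?_
    have heq : h * g * h⁻¹ * x' = 1 * x := heq
    rw [show h * g * h⁻¹ = x * x'⁻¹ by rw [eq_mul_inv_iff_mul_eq, heq, one_mul]]
    exact Finset.mul_mem_mul hx (Finset.inv_mem_inv hx'))
    (translate k⁻¹ y) (S.2 _ y hy) (translate k⁻¹ s) (S.2 _ s hs)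
  have e₁ := h₁ (Set.mem_singleton _)
  have e₂ := h₂ (Set.mem_singleton _)
  have e₃ : ∀ x ∈ S.1, x (h * g * h⁻¹) = x 1 := fun x hx => by
    conv_lhs => rw [← hfix' x hx]
    rw [translate, inv_mul_cancel]
  rw [e₃ t ht, e₃ _ (S.2 _ s hs), e₁] at e₂
  simpa [translate] using e₂

theorem faithfulSMul_points_iff {S : Shift G A} :
    FaithfulSMul G S.Points ↔ ∀ g : G, g ≠ 1 → ∃ x ∈ S.1, translate g x ≠ x := by
  constructor
  · intro hS g hg
    by_contra! h
    refine hg (hS.eq_of_smul_eq_smul fun x : S.Points => ?_)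
    rw [one_smul]
    exact Subtype.ext (h x.1 x.2)
  · intro h
    refine ⟨fun {g g'} hgg' => ?_⟩
    by_contra hne
    obtain ⟨x, hx, hne'⟩ := h (g'⁻¹ * g) fun he => hne (inv_mul_eq_one.1 he).symm
    have : (g'⁻¹ * g) • (⟨x, hx⟩ : S.Points) = ⟨x, hx⟩ := by
      rw [mul_smul, hgg', inv_smul_smul]
    exact hne' (congrArg Subtype.val this)

theorem Shift.smul_apply {S : Shift G A} (g h : G) (x : S.Points) :
    (g⁻¹ • x).1 h = x.1 (g * h) :=
  translate_inv_apply g h x.1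

variable [DiscreteTopology A]

theorem isMinimal_points_iff {S : Shift G A} : MulAction.IsMinimal G S.Points ↔
    ∀ F : Finset G, ∀ x ∈ S.1, ∀ y ∈ S.1, ∃ g, ∀ f ∈ F, x (g * f) = y f := by
  constructor
  · intro hS F x hx y hy
    obtain ⟨_, ⟨g, rfl⟩, hz⟩ := (hS.dense_orbit ⟨x, hx⟩).exists_mem_open
      ((isOpen_cylinder F.finite_toSet y).preimage continuous_subtype_val)
      ⟨⟨y, hy⟩, fun f _ => rfl⟩
    exact ⟨g⁻¹, fun f hf => hz f hf⟩
  · intro h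
    refine ⟨fun x => dense_iff_inter_open.2 ?_⟩
    rintro U hU ⟨y, hy⟩
    obtain ⟨V, hV, rfl⟩ := isOpen_induced_iff.1 hU
    obtain ⟨F, hF, hFV⟩ := exists_finite_cylinder_subset hV hy
    obtain ⟨g, hg⟩ := h hF.toFinset x.1 x.2 y.1 y.2
    refine ⟨g⁻¹ • x, hFV _ fun f hf => ?_, Set.mem_range_self _⟩
    rw [Shift.smul_apply]
    exact hg f (hF.mem_toFinset.2 hf)

theorem isProximalAction_points_iff {S : Shift G A} : IsProximalAction G S.Points ↔
    ∀ F : Finset G, ∀ x ∈ S.1, ∀ y ∈ S.1, ∃ g, ∀ f ∈ F, x (g * f) = y (g * f) := by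
  constructor
  · intro hS F x hx y hy
    obtain ⟨l, hl, z, hlx, hly⟩ := hS ⟨x, hx⟩ ⟨y, hy⟩
    have hU : Subtype.val ⁻¹' {y : G → A | ∀ f ∈ (F : Set G), y f = z.1 f} ∈ 𝓝 z :=
      ((isOpen_cylinder F.finite_toSet z.1).preimage continuous_subtype_val).mem_nhds
        fun f _ => rfl
    obtain ⟨g, hgx, hgy⟩ := ((hlx.eventually hU).and (hly.eventually hU)).exists
    exact ⟨g⁻¹, fun f hf => (hgx f hf).trans (hgy f hf).symm⟩
  · classical
    intro h x y
    choose g hg using fun F : Finset G => h F x.1 x.2 y.1 y.2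
    -- An ultrafilter finer than the net `F ↦ (g F)⁻¹` makes the orbit of `x` converge by
    -- compactness; that of `y` follows, since the two agree at `f` once `f ∈ F`.
    let u : Ultrafilter G := Ultrafilter.of (map (fun F => (g F)⁻¹) atTop)
    have hu : (u : Filter G) ≤ map (fun F => (g F)⁻¹) atTop := Ultrafilter.of_le _
    have : CompactSpace S.Points := isCompact_iff_compactSpace.1 S.1.isCompact
    obtain ⟨z, hz⟩ : ∃ z, Tendsto (fun g : G => g • x) u (𝓝 z) :=
      ⟨_, (u.map fun g : G => g • x).le_nhds_lim⟩
    refine ⟨u, inferInstance, z, hz, ?_⟩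
    rw [tendsto_subtype_rng, tendsto_pi_nhds] at hz ⊢
    intro f
    refine (hz f).congr' (hu ?_)
    rw [mem_map]
    filter_upwards [eventually_ge_atTop {f}] with F hF
    change ((g F)⁻¹ • x).1 f = ((g F)⁻¹ • y).1 f
    rw [Shift.smul_apply, Shift.smul_apply]
    exact hg F f (hF (Finset.mem_singleton_self f))

theorem faithful_minimal_proximal_iff {S : Shift G A} :
    (FaithfulSMul G S.Points ∧ MulAction.IsMinimal G S.Points ∧ IsProximalAction G S.Points) ↔
      (∀ g : {g : G // g ≠ 1}, ∃ x ∈ S.1, translate g.1 x ≠ x) ∧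
        ∀ F : Finset G, S.IsSynchronizing F := by
  rw [faithfulSMul_points_iff, isMinimal_points_iff, isProximalAction_points_iff]
  refine and_congr ⟨fun h g => h g.1 g.2, fun h g hg => h ⟨g, hg⟩⟩ ⟨fun h F x hx y hy => ?_, fun h => ?_⟩
  · exact ⟨h.1 F x hx y hy, h.2 F x hx y hy⟩
  · exact ⟨fun F x hx y hy => (h F x hx y hy).1, fun F x hx y hy => (h F x hx y hy).2⟩

/-- The generic shifts with one moving element and one synchronized window are dense. -/
theorem dense_translate_ne_inter_isSynchronizing [Nontrivial G] (hG : IsICC G) [Finite A] {g : G}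
    (hg : g ≠ 1) (F : Finset G) :
    Dense {S : genericSpace G A | (∃ x ∈ S.1.1, translate g x ≠ x) ∧
      S.1.IsSynchronizing (F : Set G)} := by
  rw [dense_iff_inter_open]
  rintro U hU ⟨S, hSU⟩
  obtain ⟨O, hO, rfl⟩ := isOpen_induced_iff.1 hU
  obtain ⟨S₁, ⟨hS₁O, hS₁t⟩, hS₁⟩ := mem_closure_iff.1 S.2.1 (O ∩ {S | S.IsTrivial}ᶜ)
    (hO.inter isClosed_isTrivial.isOpen_compl) ⟨hSU, S.2.2⟩
  -- Non-triviality and being moved by `g` are open, so they pass to subshifts with the same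
  -- `F₁`-patterns.
  obtain ⟨F₁, hF₁, hsub⟩ := exists_finite_patterns
    ((hO.inter isClosed_isTrivial.isOpen_compl).inter (isOpen_exists_translate_ne g))
    ⟨⟨hS₁O, hS₁t⟩, hS₁.exists_translate_ne hG hS₁t hg⟩
  obtain ⟨S₂, hS₂, hle, hpat⟩ := hS₁.exists_subshift hG (F := insert 1 (F ∪ F₁))
    ((F.finite_toSet.union hF₁).insert 1) (Set.insert_nonempty _ _)
  obtain ⟨⟨hS₂O, hS₂t⟩, hS₂g⟩ := hsub S₂ hle (by
    intro z hz
    obtain ⟨x, hx⟩ := S₂.1.nonempty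
    obtain ⟨a, ha⟩ := hpat x hx x hx z hz
    refine ⟨translate a⁻¹ x, S₂.2 _ x hx, fun f hf => ?_⟩
    rw [translate_inv_apply]
    exact (ha f (Or.inr (Or.inr hf))).1)
  refine ⟨⟨S₂, subset_closure hS₂, hS₂t⟩, hS₂O, hS₂g, fun x hx y hy => ?_⟩
  obtain ⟨a, ha⟩ := hpat x hx y hy y (hle hy)
  exact ⟨⟨a, fun f hf => (ha f (Or.inr (Or.inl hf))).1⟩,
    a, fun f hf => (ha f (Or.inr (Or.inl hf))).1.trans (ha f (Or.inr (Or.inl hf))).2.symm⟩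

end Dynamics

end GenericShifts

/-! ### The Baire category argument. -/

theorem mainTheorem4 {G A : Type*} [Group G] [Countable G] [Nontrivial G]
    (hG : GenericShifts.IsICC G)
    [Finite A] [Nontrivial A] [TopologicalSpace A] [DiscreteTopology A] :
    IsGδ {S : GenericShifts.genericSpace G A |
        FaithfulSMul G S.1.Points ∧ MulAction.IsMinimal G S.1.Points ∧
          GenericShifts.IsProximalAction G S.1.Points} ∧
      Dense {S : GenericShifts.genericSpace G A |
        FaithfulSMul G S.1.Points ∧ MulAction.IsMinimal G S.1.Points ∧
          GenericShifts.IsProximalAction G S.1.Points} := by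
  -- Needed to recover the window conditions from the sets `U`, which are indexed by pairs.
  obtain ⟨g₀, hg₀⟩ := exists_ne (1 : G)
  let U : {g : G // g ≠ 1} × Finset G → Set (GenericShifts.genericSpace G A) := fun p =>
    {S | (∃ x ∈ S.1.1, GenericShifts.translate p.1.1 x ≠ x) ∧
      S.1.IsSynchronizing (p.2 : Set G)}
  have hU : {S : GenericShifts.genericSpace G A |
        FaithfulSMul G S.1.Points ∧ MulAction.IsMinimal G S.1.Points ∧
          GenericShifts.IsProximalAction G S.1.Points} = ⋂ p, U p := by
    ext S
    rw [Set.mem_iInter]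
    refine GenericShifts.faithful_minimal_proximal_iff.trans
      ⟨fun h p => ⟨h.1 p.1, h.2 p.2⟩, fun h => ⟨fun g => (h (g, ∅)).1, fun F => ?_⟩⟩
    exact (h (⟨g₀, hg₀⟩, F)).2
  have hopen : ∀ p, IsOpen (U p) := fun p =>
    ((GenericShifts.isOpen_exists_translate_ne p.1.1).inter
      (GenericShifts.isOpen_isSynchronizing p.2.finite_toSet)).preimage continuous_subtype_val
  rw [hU]
  exact ⟨.iInter_of_isOpen hopen, dense_iInter_of_isOpen hopen fun p =>
    GenericShifts.dense_translate_ne_inter_isSynchronizing hG p.1.2 p.2⟩
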